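/- Let $n\ge 1$ and let $S_n=\sum_{i=1}^n Y_i$ be a sum of independent random variables $Y_i=B_iX_i$, where for each $i$ the variables $B_i$ and $X_i$ are independent, $B_i\sim\mathrm{Bern}(p_i)$ with $p_i\in[0,1]$, and $X_i$ has distribution $Q_i$ on $\{1,2,3,\dots\}$ with finite mean. Assume that every $Q_i$ has full support, i.e. $Q_i(k)>0$ for all $k\ge 1$. Let $\lambda=\sum_{i=1}^n p_i$, assume $\lambda>0$, let $Q=\sum_{i=1}^n\frac{p_i}{\lambda}Q_i$, and let $P_{S_n}$ denote the distribution of $S_n$. Let $\mathrm{CPo}(\lambda,Q)$ be the compound Poisson law, i.e. the distribution of $\sum_{j=1}^Z \xi_j$ where $Z$ is Poisson with parameter $\lambda$ and the $\xi_j$ are i.i.d. with distribution $Q$, independent of $Z$; and let $d_{\mathrm{TV}}(P,R)=\frac12\sum_{x\ge 0}|P(x)-R(x)|$. Then $$ d_{\mathrm{TV}}\big(P_{S_n},\mathrm{CPo}(\lambda,Q)\big)\;\le\; H(\lambda,Q)\left\{\sum_{i=1}^n\left[p_i^3\sum_{y\ge 1}Q_i(y)\,y^2\Big(\frac{Q_i^{*2}(y)}{2Q_i(y)}-1\Big)^2\right]\right\}^{1/2},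 $$ where $Q_i^{*2}=Q_i*Q_i$ denotes the convolution, the right-hand side is allowed to be $+\infty$ (with $0\cdot\infty=0$), and the Stein factor $H(\lambda,Q)$ is defined as follows. If the sequence $(jQ(j))_{j\ge1}$ is non-increasing, put $\delta=[\lambda\{Q(1)-2Q(2)\}]^{-1}$ (with $1/0=\infty$), and $H(\lambda,Q)=1$ if $\delta\ge 1$, $H(\lambda,Q)=\sqrt{\delta}\,(2-\sqrt{\delta})$ if $\delta<1$. Otherwise $H(\lambda,Q)=e^{\lambda}\min\{1,\tfrac{1}{\lambda Q(1)}\}$. -/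

import Mathlib

open MeasureTheory ProbabilityTheory
open scoped ENNReal NNReal

/-- Total variation distance `(1/2) ∑ₖ |P(k) - R(k)|` of two probability measures on
`ℕ = {0, 1, 2, …}` (for finite measures the series converges). -/
noncomputable def tvDist (P R : Measure ℕ) : ℝ :=
  (1 / 2) * ∑' k : ℕ, |P.real {k} - R.real {k}|

/-- `iidSum Q z` is the law of `X₁ + ⋯ + X_z`, where the `Xⱼ` are i.i.d. with law `Q`
(the `z`-fold convolution power of `Q`; the empty sum is `0`). -/
noncomputable def iidSum (Q : Measure ℕ) : ℕ → Measure ℕ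
  | 0 => Measure.dirac 0
  | z + 1 => (iidSum Q z).conv Q

/-- The compound Poisson law `CPo(l, Q)`: the law of `X₁ + ⋯ + X_Z`, where `Z` is Poisson with
parameter `l` and the `Xⱼ` are i.i.d. with law `Q`, independent of `Z`. -/
noncomputable def compoundPoisson (l : ℝ≥0) (Q : Measure ℕ) : Measure ℕ :=
  (poissonMeasure l).bind (iidSum Q)

/-- `δ = [l (Q(1) - 2 Q(2))]⁻¹`, an extended number: it is `∞` when `Q(1) = 2 Q(2)`. It is used
only when `(j Q(j))` is non-increasing, so that `Q(1) - 2 Q(2) ≥ 0`. -/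
noncomputable def steinDelta (l : ℝ≥0) (Q : Measure ℕ) : ℝ≥0∞ :=
  (ENNReal.ofReal (l * (Q.real {1} - 2 * Q.real {2})))⁻¹

open Classical in
/-- `H₀(l, Q)`, equal to `1` if `δ ≥ 1` and to `√δ (2 - √δ)` if `δ < 1`. -/
noncomputable def steinFactorZero (l : ℝ≥0) (Q : Measure ℕ) : ℝ≥0∞ :=
  if 1 ≤ steinDelta l Q then 1
  else ENNReal.ofReal
    (Real.sqrt (steinDelta l Q).toReal * (2 - Real.sqrt (steinDelta l Q).toReal))

open Classical in
/-- The Stein factor `H(l, Q)` of a distribution `Q` on `{1, 2, …}`: it is `H₀(l, Q)` if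
`(j Q(j))_{j ≥ 1}` is non-increasing, and `e^l min {1, 1 / (l Q(1))}` otherwise
(where `1 / 0 = ∞`). -/
noncomputable def steinFactor (l : ℝ≥0) (Q : Measure ℕ) : ℝ≥0∞ :=
  if AntitoneOn (fun j : ℕ => (j : ℝ) * Q.real {j}) (Set.Ici 1) then steinFactorZero l Q
  else ENNReal.ofReal (Real.exp l) * min 1 (ENNReal.ofReal (l * Q.real {1}))⁻¹

/-- `∑_y Q(y) y² (Q^{*2}(y) / (2 Q(y)) - 1)²`, with value in `[0, ∞]`; `Q` is a distribution on
`{1, 2, …}` that gives mass to each point, and the term `y = 0` of the series vanishes. -/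
noncomputable def convDefect (Q : Measure ℕ) : ℝ≥0∞ :=
  ∑' y : ℕ, ENNReal.ofReal
    (Q.real {y} * (y : ℝ) ^ 2 * ((Q.conv Q).real {y} / (2 * Q.real {y}) - 1) ^ 2)

/-! The proof is Stein's method. Put `a j = λ j Q(j)` and let the operator A send g to `w ↦ ∑ a j
g(w+j) - w g(w)`. The law CPo(λ,Q) integrates A g to zero for bounded g, by size-biasing the
compound Poisson sum. If f is the indicator of the set where the law of S exceeds CPo(λ,Q), and g
solves A g = f - E f(CPo), then the total variation distance is E (A g)(S).

Since λQ is the sum of the p_i Q_i, the operator splits over the summands. With the other summands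
held fixed, `integral_stein_summand` turns the i-th part into E[r_i(Y_i) g(S)], where r_i is
`bernoulliScore`. The scores are independent, are centred (take g = 1) and have second moment p_i³
times `convDefect`. Hence the distance is at most sup|g| E|∑ r_i|, and Cauchy–Schwarz yields the
square root of the sum of variances.

It remains to bound sup|g| by H(λ,Q), in `exists_stein_solution_compoundPoisson`. In general g is a
fixed point dominated by an explicit integral φ, with w φ(w) ≤ e^λ and λQ(1) φ(w) ≤ e^λ. If jQ(j) is
non-increasing, write g as the increment of h: then A g is the generator, applied to h, of an
immigration-death process with batches of size j at rate a_j - a_{j+1} and unit per-capita death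
rate. A maximum principle imitating the coupling of two such processes bounds g in
`stein_solution_le_of_antitone`. -/

/-! ### The Stein equation for general Q: a dominating function and a fixed point. -/

/-- The function `φ(w) = ∫₀¹ u^(w-1) exp (∑ c_j - ∑ c_j u^j) du` solves
`w φ(w) = 1 + ∑ j c_j φ(w+j)`; it dominates the solutions of Stein equations. -/
lemma exists_stein_dominating (c : ℕ → ℝ) (hc : ∀ j, 0 ≤ c j) (hc0 : c 0 = 0)
    (hs : Summable fun j : ℕ => j * c j) :
    ∃ φ : ℕ → ℝ, ∀ w, 1 ≤ w → 0 ≤ φ w ∧ Summable (fun j : ℕ => j * c j * φ (w + j)) ∧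
      w * φ w = 1 + ∑' j : ℕ, j * c j * φ (w + j) ∧
      w * φ w ≤ Real.exp (∑' j, c j) ∧ c 1 * φ w ≤ Real.exp (∑' j, c j) := by
  have hsc : Summable c := by
    refine Summable.of_nonneg_of_le hc (fun j => ?_) hs
    rcases j with _ | j
    · simp [hc0]
    · have := hc (j + 1)
      push_cast
      nlinarith [(Nat.cast_nonneg j : (0 : ℝ) ≤ j)]
  set Λ := ∑' j, c j with hΛ
  set L : ℝ → ℝ := fun u => ∑' j, c j * u ^ j with hL
  set L' : ℝ → ℝ := fun u => ∑' j : ℕ, c j * (j * u ^ (j - 1)) with hL'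
  set ψ : ℝ → ℝ := fun u => Real.exp (Λ - L u) with hψ
  have hpow : ∀ u ∈ Set.Icc (0 : ℝ) 1, ∀ k : ℕ, 0 ≤ u ^ k ∧ u ^ k ≤ 1 := fun u hu k =>
    ⟨pow_nonneg hu.1 k, pow_le_one₀ hu.1 hu.2⟩
  have hsu : ∀ u ∈ Set.Icc (0 : ℝ) 1, Summable fun j => c j * u ^ j := fun u hu =>
    Summable.of_nonneg_of_le (fun j => mul_nonneg (hc j) (hpow u hu j).1)
      (fun j => mul_le_of_le_one_right (hc j) (hpow u hu j).2) hsc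
  have hLcont : ContinuousOn L (Set.Icc 0 1) := by
    refine continuousOn_tsum (u := c) (fun j => by fun_prop) hsc fun j u hu => ?_
    rw [Real.norm_of_nonneg (mul_nonneg (hc j) (hpow u hu j).1)]
    exact mul_le_of_le_one_right (hc j) (hpow u hu j).2
  have hbd' : ∀ j : ℕ, ∀ u ∈ Set.Icc (0 : ℝ) 1, ‖c j * (j * u ^ (j - 1))‖ ≤ j * c j := by
    intro j u hu
    have h0 := (hpow u hu (j - 1)).1
    rw [Real.norm_of_nonneg (mul_nonneg (hc j) (mul_nonneg j.cast_nonneg h0))]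
    have := mul_le_of_le_one_right (mul_nonneg (Nat.cast_nonneg j) (hc j)) (hpow u hu (j - 1)).2
    linarith
  have hL'cont : ContinuousOn L' (Set.Icc 0 1) :=
    continuousOn_tsum (fun j => by fun_prop) hs hbd'
  have hψcont : ContinuousOn ψ (Set.Icc 0 1) := by
    simp only [hψ]; fun_prop
  have hderiv : ∀ u ∈ Set.Ioo (0 : ℝ) 1, HasDerivAt L (L' u) u := by
    intro u hu
    refine hasDerivAt_tsum_of_isPreconnected (t := Set.Ioo (0 : ℝ) 1) (y₀ := u) hs isOpen_Ioo
      isPreconnected_Ioo (fun j y hy => ?_) (fun j y hy => hbd' j y ⟨hy.1.le, hy.2.le⟩) hu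
      (hsu u ⟨hu.1.le, hu.2.le⟩) hu
    exact (hasDerivAt_pow j y).const_mul (c j)
  have hL1 : L 1 = Λ := by simp [hL, hΛ]
  have hLnn : ∀ u ∈ Set.Icc (0 : ℝ) 1, c 1 * u ≤ L u := by
    intro u hu
    have := (hsu u hu).le_tsum 1 fun j _ => mul_nonneg (hc j) (hpow u hu j).1
    simpa using this
  have hψle : ∀ u ∈ Set.Icc (0 : ℝ) 1, ψ u ≤ Real.exp (Λ - c 1 * u) := fun u hu =>
    Real.exp_le_exp.2 (by linarith [hLnn u hu])
  have hψle' : ∀ u ∈ Set.Icc (0 : ℝ) 1, ψ u ≤ Real.exp Λ := fun u hu =>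
    (hψle u hu).trans (Real.exp_le_exp.2 (by nlinarith [mul_nonneg (hc 1) hu.1]))
  have hψ0 : ∀ u, 0 < ψ u := fun u => Real.exp_pos _
  have hint : ∀ k : ℕ, IntervalIntegrable (fun u => u ^ k * ψ u) volume 0 1 := fun k => by
    apply ContinuousOn.intervalIntegrable
    rw [Set.uIcc_of_le zero_le_one]
    fun_prop
  have hint' : ∀ k : ℕ, IntervalIntegrable (fun u => u ^ k * (L' u * ψ u)) volume 0 1 := fun k => by
    apply ContinuousOn.intervalIntegrable
    rw [Set.uIcc_of_le zero_le_one]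
    fun_prop
  refine ⟨fun w => ∫ u in (0 : ℝ)..1, u ^ (w - 1) * ψ u, fun w hw => ?_⟩
  have hsum : HasSum (fun j : ℕ => ∫ u in (0 : ℝ)..1, j * c j * (u ^ (w + j - 1) * ψ u))
      (∫ u in (0 : ℝ)..1, u ^ w * (L' u * ψ u)) := by
    refine intervalIntegral.hasSum_integral_of_dominated_convergence
      (fun j _ => j * c j * Real.exp Λ) (fun j => ?_) (fun j => ?_) ?_ ?_ ?_
    · rw [Set.uIoc_of_le zero_le_one]
      exact ((hint _).const_mul _).1.aestronglyMeasurable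
    · refine Filter.Eventually.of_forall fun u hu => ?_
      rw [Set.uIoc_of_le zero_le_one] at hu
      have hu' : u ∈ Set.Icc (0 : ℝ) 1 := ⟨hu.1.le, hu.2⟩
      have h1 := hpow u hu' (w + j - 1)
      rw [Real.norm_of_nonneg (mul_nonneg (mul_nonneg j.cast_nonneg (hc j))
        (mul_nonneg h1.1 (hψ0 u).le))]
      refine mul_le_mul_of_nonneg_left ?_ (mul_nonneg j.cast_nonneg (hc j))
      exact (mul_le_of_le_one_left (hψ0 u).le h1.2).trans (hψle' u hu')
    · exact Filter.Eventually.of_forall fun u _ => hs.mul_right _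
    · exact intervalIntegrable_const
    · refine Filter.Eventually.of_forall fun u hu => ?_
      rw [Set.uIoc_of_le zero_le_one] at hu
      have hu' : u ∈ Set.Icc (0 : ℝ) 1 := ⟨hu.1.le, hu.2⟩
      have h2 : Summable fun j : ℕ => c j * (j * u ^ (j - 1)) :=
        Summable.of_norm_bounded hs fun j => hbd' j u hu'
      have h3 := (h2.hasSum.mul_right (ψ u)).mul_left (u ^ w)
      refine (funext fun j => ?_ : (fun j : ℕ => j * c j * (u ^ (w + j - 1) * ψ u)) = _) ▸ h3
      rcases j with _ | j
      · simp
      · rw [show w + (j + 1) - 1 = w + j by omega, pow_add]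
        simp only [Nat.add_sub_cancel]
        ring
  simp only [intervalIntegral.integral_const_mul] at hsum
  -- The integrand is the derivative of u^w ψ(u), which is 1 at u = 1 because L(1) = Λ, and 0 at u =
  -- 0 because w ≥ 1.
  have hftc : ∫ u in (0 : ℝ)..1, (w * (u ^ (w - 1) * ψ u) - u ^ w * (L' u * ψ u)) = 1 := by
    rw [intervalIntegral.integral_eq_sub_of_hasDerivAt_of_le (f := fun u => u ^ w * ψ u) zero_le_one]
    · have hw0 : w ≠ 0 := by omega
      simp [hψ, hL1, hw0]
    · fun_prop
    · intro u hu
      have h1 := ((hderiv u hu).const_sub Λ).exp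
      have h2 : HasDerivAt (fun u => u ^ w * ψ u) _ u := (hasDerivAt_pow w u).mul h1
      refine h2.congr_deriv ?_
      simp only [hψ]
      ring
    · exact ((hint _).const_mul _).sub (hint' _)
  rw [intervalIntegral.integral_sub ((hint _).const_mul _) (hint' _),
    intervalIntegral.integral_const_mul] at hftc
  have hφ0 : 0 ≤ ∫ u in (0 : ℝ)..1, u ^ (w - 1) * ψ u :=
    intervalIntegral.integral_nonneg zero_le_one fun u hu =>
      mul_nonneg (hpow u hu _).1 (hψ0 u).le
  refine ⟨hφ0, hsum.summable, ?_, ?_, ?_⟩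
  · rw [hsum.tsum_eq]; linarith
  · have h1 : ∫ u in (0 : ℝ)..1, u ^ (w - 1) * ψ u ≤
        ∫ u in (0 : ℝ)..1, u ^ (w - 1) * Real.exp Λ := by
      refine intervalIntegral.integral_mono_on zero_le_one (hint _)
        (Continuous.intervalIntegrable (by fun_prop) _ _) fun u hu => ?_
      exact mul_le_mul_of_nonneg_left (hψle' u hu) (hpow u hu _).1
    rw [intervalIntegral.integral_mul_const, integral_pow] at h1
    have hw0 : (0 : ℝ) < w := by exact_mod_cast hw
    have h2 : ((w - 1 : ℕ) : ℝ) + 1 = w := by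
      have : w - 1 + 1 = w := by omega
      exact_mod_cast this
    rw [h2, show w - 1 + 1 = w by omega, one_pow, zero_pow (by omega), sub_zero] at h1
    calc (w : ℝ) * _ ≤ w * (1 / w * Real.exp Λ) := mul_le_mul_of_nonneg_left h1 hw0.le
      _ = Real.exp Λ := by field_simp
  -- Keeping only the term j = 1 of L gives ψ(u) ≤ exp(Λ - c₁u), and c₁ times this integrates to
  -- less than e^Λ.
  · have h1 : c 1 * ∫ u in (0 : ℝ)..1, u ^ (w - 1) * ψ u ≤
        ∫ u in (0 : ℝ)..1, c 1 * Real.exp (Λ - c 1 * u) := by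
      rw [← intervalIntegral.integral_const_mul]
      refine intervalIntegral.integral_mono_on zero_le_one ((hint _).const_mul _)
        (Continuous.intervalIntegrable (by fun_prop) _ _) fun u hu => ?_
      refine mul_le_mul_of_nonneg_left ?_ (hc 1)
      exact (mul_le_of_le_one_left (hψ0 u).le (hpow u hu _).2).trans (hψle u hu)
    have h2 : ∫ u in (0 : ℝ)..1, c 1 * Real.exp (Λ - c 1 * u) =
        Real.exp Λ - Real.exp (Λ - c 1) := by
      rw [intervalIntegral.integral_eq_sub_of_hasDerivAt
        (f := fun u => - Real.exp (Λ - c 1 * u))]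
      · simp; ring
      · intro u _
        have : HasDerivAt (fun u => - Real.exp (Λ - c 1 * u)) _ u :=
          ((((hasDerivAt_id u).const_mul (c 1)).const_sub Λ).exp).neg
        refine this.congr_deriv ?_
        simp only [id, mul_one, mul_neg, neg_neg]
        ring
      · exact Continuous.intervalIntegrable (by fun_prop) _ _
    rw [h2] at h1
    linarith [Real.exp_pos (Λ - c 1)]

/-- The Stein equation away from the origin has a solution dominated by any function `φ` as in
`exists_stein_dominating`. -/
lemma exists_stein_solution (a φ f : ℕ → ℝ) (K : ℝ) (ha : ∀ j, 0 ≤ a j)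
    (hφ : ∀ w, 1 ≤ w → 0 ≤ φ w ∧ Summable (fun j : ℕ => a j * φ (w + j)) ∧
      w * φ w = 1 + ∑' j : ℕ, a j * φ (w + j) ∧ w * φ w ≤ K)
    (hf : ∀ w, |f w| ≤ 1) :
    ∃ g : ℕ → ℝ, (∀ w, 1 ≤ w → |g w| ≤ φ w) ∧ g 0 = 0 ∧
      ∀ w, 1 ≤ w → ∑' j, a j * g (w + j) - w * g w = f w := by
  have hsm : ∀ (h : ℕ → ℝ) (C : ℝ), (∀ w, 1 ≤ w → |h w| ≤ C * φ w) → ∀ w, 1 ≤ w →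
      Summable (fun j => a j * h (w + j)) ∧
        |∑' j, a j * h (w + j)| ≤ C * ∑' j, a j * φ (w + j) := by
    intro h C hh w hw
    have hb : ∀ j, ‖a j * h (w + j)‖ ≤ C * (a j * φ (w + j)) := fun j => by
      rw [norm_mul, Real.norm_of_nonneg (ha j), Real.norm_eq_abs]
      have := mul_le_mul_of_nonneg_left (hh (w + j) (by omega)) (ha j)
      linarith
    have hs := (hφ w hw).2.1.mul_left C
    refine ⟨Summable.of_norm_bounded hs hb, ?_⟩
    rw [← tsum_mul_left]
    exact tsum_of_norm_bounded hs.hasSum hb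
  -- Solutions are fixed points of T. In the sup norm weighted by φ, T contracts: ∑ a_j φ(w+j) =
  -- wφ(w) - 1 and wφ(w) ≤ K give the factor 1 - 1/K.
  let T : (ℕ → ℝ) → ℕ → ℝ := fun h w => (∑' j, a j * h (w + j) - f w) / w
  let g : ℕ → ℕ → ℝ := fun m => T^[m] 0
  have hg : ∀ m, g (m + 1) = T (g m) := fun m => Function.iterate_succ_apply' T m 0
  have hw' : ∀ w : ℕ, 1 ≤ w → (0 : ℝ) < w := fun w hw => by exact_mod_cast hw
  have hK : 1 ≤ K := by
    obtain ⟨h1, h2, h3, h4⟩ := hφ 1 le_rfl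
    have : 0 ≤ ∑' j : ℕ, a j * φ (1 + j) :=
      tsum_nonneg fun j => mul_nonneg (ha j) (hφ _ (by omega)).1
    linarith
  set ρ := 1 - 1 / K with hρ
  have hρ0 : 0 ≤ ρ := by
    have : 1 / K ≤ 1 := by rw [div_le_one (by linarith)]; exact hK
    linarith
  have hρ1 : ρ < 1 := by
    have : 0 < 1 / K := by positivity
    linarith
  have hcontr : ∀ w, 1 ≤ w → ∑' j : ℕ, a j * φ (w + j) ≤ ρ * (w * φ w) := by
    intro w hw
    obtain ⟨h1, h2, h3, h4⟩ := hφ w hw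
    have : (w * φ w) / K ≤ 1 := by rw [div_le_one (by linarith)]; exact h4
    have h5 : ρ * (w * φ w) = w * φ w - w * φ w / K := by rw [hρ]; ring
    linarith
  have hgφ : ∀ m w, 1 ≤ w → |g m w| ≤ φ w := by
    intro m
    induction m with
    | zero => intro w hw; simpa [g] using (hφ w hw).1
    | succ m ih =>
      intro w hw
      have h1 := (hsm (g m) 1 (by simpa using ih) w hw).2
      rw [hg]
      simp only [T]
      rw [abs_div, abs_of_pos (hw' w hw), div_le_iff₀ (hw' w hw)]
      have := abs_sub (∑' j, a j * g m (w + j)) (f w)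
      have := (hφ w hw).2.2.1
      linarith [hf w]
  have hdiff : ∀ m w, 1 ≤ w → |g m w - g (m + 1) w| ≤ ρ ^ m * φ w := by
    intro m
    induction m with
    | zero =>
      intro w hw
      have := hgφ 1 w hw
      simpa [g] using this
    | succ m ih =>
      intro w hw
      have h1 := (hsm (fun w => g m w - g (m + 1) w) (ρ ^ m) ih w hw).2
      have e : ∑' j, a j * (g m (w + j) - g (m + 1) (w + j)) =
          ∑' j, a j * g m (w + j) - ∑' j, a j * g (m + 1) (w + j) := by
        rw [← Summable.tsum_sub]
        · simp only [mul_sub]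
        · exact (hsm (g m) 1 (by simpa using hgφ m) w hw).1
        · exact (hsm (g (m + 1)) 1 (by simpa using hgφ (m + 1)) w hw).1
      rw [e] at h1
      rw [hg m, hg (m + 1)]
      simp only [T]
      rw [← sub_div, abs_div, abs_of_pos (hw' w hw), div_le_iff₀ (hw' w hw)]
      calc |∑' j, a j * g m (w + j) - f w - (∑' j, a j * g (m + 1) (w + j) - f w)|
          = |∑' j, a j * g m (w + j) - ∑' j, a j * g (m + 1) (w + j)| := by ring_nf
        _ ≤ ρ ^ m * (ρ * (w * φ w)) :=
          h1.trans (mul_le_mul_of_nonneg_left (hcontr w hw) (pow_nonneg hρ0 m))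
        _ = ρ ^ (m + 1) * φ w * w := by ring
  have hlim : ∀ w, ∃ x, 1 ≤ w → Filter.Tendsto (fun m => g m w) Filter.atTop (nhds x) := by
    intro w
    by_cases hw : 1 ≤ w
    · obtain ⟨x, hx⟩ := cauchySeq_tendsto_of_complete
        (cauchySeq_of_le_geometric ρ (φ w) hρ1 (f := fun m => g m w) fun m => by
          rw [Real.dist_eq, mul_comm]; exact hdiff m w hw)
      exact ⟨x, fun _ => hx⟩
    · exact ⟨0, fun h => absurd h hw⟩
  choose G hG using hlim
  refine ⟨fun w => if w = 0 then 0 else G w, fun w hw => ?_, by simp, fun w hw => ?_⟩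
  · have hw0 : w ≠ 0 := by omega
    simp only [hw0, if_false]
    exact le_of_tendsto (hG w hw).abs (Filter.Eventually.of_forall fun m => hgφ m w hw)
  · have hne : ∀ j, w + j ≠ 0 := fun j => by omega
    have hw0 : w ≠ 0 := by omega
    simp only [hne, hw0, if_false]
    have h1 : Filter.Tendsto (fun m => ∑' j, a j * g m (w + j)) Filter.atTop
        (nhds (∑' j, a j * G (w + j))) := by
      refine tendsto_tsum_of_dominated_convergence (hφ w hw).2.1
        (fun j => (hG (w + j) (by omega)).const_mul _)
        (Filter.Eventually.of_forall fun m j => ?_)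
      rw [norm_mul, Real.norm_of_nonneg (ha j), Real.norm_eq_abs]
      exact mul_le_mul_of_nonneg_left (hgφ m _ (by omega)) (ha j)
    have h2 := (h1.sub_const (f w)).div_const (w : ℝ)
    have h3 := tendsto_nhds_unique ((hG w hw).comp (Filter.tendsto_add_atTop_nat 1))
      (h2.congr fun m => by simp only [Function.comp, hg m]; rfl)
    have hpos := hw' w hw
    rw [h3]
    field_simp
    ring

/-! ### The maximum principle for non-increasing jQ(j). -/

/-- Summation by parts against a non-increasing sequence. -/
lemma tsum_mul_sub_le_of_antitone (a b u : ℕ → ℝ) (ha : ∀ j, 0 ≤ a j) (ha0 : a 0 = 0)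
    (hanti : ∀ j, 1 ≤ j → a (j + 1) ≤ a j) (hu0 : u 0 = 0) (hu : ∀ j, u j ≤ 0)
    (hb : ∀ j, b (j + 1) = u (j + 1) - u j) (hs : Summable fun j => a j * b j) :
    ∑' j, a j * b j ≤ (a 1 - a 2) * u 1 := by
  -- Abel summation gives ∑ (a_j - a_{j+1}) u_j plus a boundary term. All terms are nonpositive, and
  -- only j = 1 is kept.
  have key : ∀ N, ∑ j ∈ Finset.range (N + 3), a j * b j ≤
      (a 1 - a 2) * u 1 + a (N + 2) * u (N + 2) := by
    intro N
    induction N with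
    | zero =>
      have h1 := hb 0
      have h2 := hb 1
      norm_num at h1 h2
      simp only [Finset.sum_range_succ, Finset.sum_range_zero, ha0, h1, h2, hu0]
      linarith
    | succ N ih =>
      rw [Finset.sum_range_succ, show N + 1 + 2 = N + 2 + 1 by ring, hb (N + 2)]
      have := mul_nonneg_of_nonpos_of_nonpos
        (sub_nonpos.2 (hanti (N + 2) (by omega))) (hu (N + 2))
      linarith
  refine le_of_tendsto (hs.hasSum.tendsto_sum_nat.comp (Filter.tendsto_add_atTop_nat 3))
    (Filter.Eventually.of_forall fun N => (key N).trans ?_)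
  have := mul_nonpos_of_nonneg_of_nonpos (ha (N + 2)) (hu (N + 2))
  linarith

/-- An explicit bound for the expected time at which two coupled batch immigration-death
processes meet, in the form of a supersolution. -/
lemma exists_meeting_time_bound (D : ℕ) (hD : 1 ≤ D) (ν : ℝ) (hDν : ((D : ℝ) - 1) ^ 2 ≤ ν) :
    ∃ V : ℕ → ℝ, (∀ d, 1 / (D : ℝ) ≤ V d) ∧
      (∀ d, 1 ≤ d → ν * (V (d + 1) - V d) - d * V d ≤ -1) ∧
      V 1 = 2 / D - 1 / (D : ℝ) ^ 2 := by
  have hD0 : (0 : ℝ) < D := by exact_mod_cast hD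
  -- V decreases linearly up to d = D and is constant 1/D beyond. For d < D the inequality amounts
  -- to (D - d)² ≤ ν, whose worst case is d = 1.
  refine ⟨fun d => 2 / D - (min d D : ℕ) / (D : ℝ) ^ 2, fun d => ?_, fun d hd => ?_, ?_⟩
  · have h1 : ((min d D : ℕ) : ℝ) ≤ D := by exact_mod_cast min_le_right d D
    have h2 : ((min d D : ℕ) : ℝ) / (D : ℝ) ^ 2 ≤ 1 / D := by
      rw [div_le_div_iff₀ (by positivity) hD0]; nlinarith
    have h3 : (2 : ℝ) / D = 1 / D + 1 / D := by ring
    linarith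
  · rcases lt_or_ge d D with h | h
    · have e1 : min d D = d := by omega
      have e2 : min (d + 1) D = d + 1 := by omega
      simp only [e1, e2]
      have h4 : ((D : ℝ) - d) ^ 2 ≤ ν := by
        refine le_trans ?_ hDν
        have h5 : (1 : ℝ) ≤ d := by exact_mod_cast hd
        have h6 : (d : ℝ) ≤ D := by exact_mod_cast h.le
        exact pow_le_pow_left₀ (by linarith) (by linarith) 2
      have h5 : ((D : ℝ) - d) ^ 2 / (D : ℝ) ^ 2 ≤ ν / (D : ℝ) ^ 2 := by gcongr
      have h6 : ((D : ℝ) - d) ^ 2 / (D : ℝ) ^ 2 = 1 - 2 * d / D + d ^ 2 / (D : ℝ) ^ 2 := by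
        field_simp; ring
      push_cast
      have h7 : ν * (2 / D - ((d : ℝ) + 1) / (D : ℝ) ^ 2 -
          (2 / D - d / (D : ℝ) ^ 2)) - d * (2 / D - d / (D : ℝ) ^ 2)
          = - (ν / (D : ℝ) ^ 2) - 2 * d / D + d ^ 2 / (D : ℝ) ^ 2 := by ring
      rw [h7]; linarith
    · have e1 : min d D = D := by omega
      have e2 : min (d + 1) D = D := by omega
      simp only [e1, e2, sub_self, mul_zero, zero_sub, neg_le_neg_iff]
      have h6 : (D : ℝ) ≤ d := by exact_mod_cast h
      have h7 : (2 : ℝ) / D - D / (D : ℝ) ^ 2 = 1 / D := by field_simp; ring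
      rw [h7, mul_one_div, le_div_iff₀ hD0]; linarith
  · have : min 1 D = 1 := by omega
    simp [this]

/-- Each of the steps below N costs at most K; from N on, the decay K/(w+1) makes a step cost at
most 1/(2D), half the slope that `exists_max_increment` assumes for ω. -/
lemma increment_le_of_increment_decay (h : ℕ → ℝ) (K : ℝ) (D N : ℕ) (hD : 1 ≤ D)
    (hN : 2 * D * K ≤ N) (hg : ∀ w : ℕ, (w + 1) * |h (w + 1) - h w| ≤ K) (x d : ℕ) :
    h (x + d) - h x ≤ K * ((min (x + d) N : ℕ) - (min x N : ℕ) : ℝ) + d / (2 * D) := by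
  have hD0 : (0 : ℝ) < D := by exact_mod_cast hD
  induction d with
  | zero => simp
  | succ d ih =>
    have hg1 := hg (x + d)
    have hg2 := le_abs_self (h (x + d + 1) - h (x + d))
    have hab := abs_nonneg (h (x + d + 1) - h (x + d))
    have : h (x + d + 1) - h (x + d) ≤
        K * ((min (x + d + 1) N : ℕ) - (min (x + d) N : ℕ) : ℝ) + 1 / (2 * D) := by
      have hpos : 0 ≤ 1 / (2 * (D : ℝ)) := by positivity
      refine hg2.trans ?_
      generalize |h (x + d + 1) - h (x + d)| = t at *
      push_cast at hg1
      have hxd : (0 : ℝ) ≤ (x : ℝ) + d := by positivity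
      rcases Nat.lt_or_ge (x + d) N with h1 | h1
      · have e1 : min (x + d + 1) N = x + d + 1 := by omega
        have e2 : min (x + d) N = x + d := by omega
        rw [e1, e2]; push_cast
        nlinarith
      · have e1 : min (x + d + 1) N = N := by omega
        have e2 : min (x + d) N = N := by omega
        rw [e1, e2, sub_self, mul_zero, zero_add, le_div_iff₀ (by positivity)]
        have h2 : (N : ℝ) ≤ x + d := by exact_mod_cast h1
        have h3 : ((x : ℝ) + d + 1) * (t * (2 * D)) ≤ (x + d + 1) * 1 := by nlinarith
        exact le_of_mul_le_mul_left h3 (by linarith)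
    rw [← add_assoc]
    push_cast at this ih ⊢
    rw [add_div]; linarith

/-- If the increments of `h` decay, then the excess of `h (x + d) - h x` over a function of `d`
of linear growth attains its maximum, if it is positive somewhere. -/
lemma exists_max_increment (h ω : ℕ → ℝ) (K : ℝ) (D : ℕ) (hD : 1 ≤ D) (hK : 0 ≤ K)
    (hg : ∀ w : ℕ, (w + 1) * |h (w + 1) - h w| ≤ K) (hω : ∀ d : ℕ, (d : ℝ) / D ≤ ω d)
    (hcon : ∃ x d, 0 < h (x + d) - h x - ω d) :
    ∃ x d M, 0 < M ∧ h (x + d) = h x + ω d + M ∧ ∀ x' d', h (x' + d') ≤ h x' + ω d' + M := by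
  have hD0 : (0 : ℝ) < D := by exact_mod_cast hD
  obtain ⟨N, hN⟩ := exists_nat_ge (2 * D * K)
  obtain ⟨N', hN'⟩ := exists_nat_gt (2 * D * (K * N))
  let Φ : ℕ × ℕ → ℝ := fun p => h (p.1 + p.2) - h p.1 - ω p.2
  have hΦ : ∀ x d, Φ (x, d) = h (x + d) - h x - ω d := fun _ _ => rfl
  -- A positive excess needs steps below N, so x < N. Those steps gain at most KN, which must beat
  -- d/(2D), so d < N'. The maximum is thus over a finite box.
  have hfin : ∀ x d, 0 < Φ (x, d) → (x, d) ∈ Finset.range N ×ˢ Finset.range N' := by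
    intro x d hp
    rw [hΦ] at hp
    have h1 := increment_le_of_increment_decay h K D N hD hN hg x d
    have h2 := hω d
    have h4 : (0 : ℝ) ≤ (d : ℝ) / D := by positivity
    have h5 : (d : ℝ) / (2 * D) = d / D - d / D / 2 := by field_simp; ring
    rw [Finset.mem_product, Finset.mem_range, Finset.mem_range]
    constructor
    · by_contra hx
      have e1 : min (x + d) N = N := by grind
      have e2 : min x N = N := by grind
      rw [e1, e2, sub_self, mul_zero] at h1
      linarith
    · have h6 : ((min (x + d) N : ℕ) - (min x N : ℕ) : ℝ) ≤ N := by
        have : ((min (x + d) N : ℕ) : ℝ) ≤ N := by exact_mod_cast min_le_right _ _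
        have : (0 : ℝ) ≤ (min x N : ℕ) := Nat.cast_nonneg _
        linarith
      have h7 := mul_le_mul_of_nonneg_left h6 hK
      have h8 : (d : ℝ) / D / 2 < K * N := by linarith
      have h9 : (d : ℝ) < N' := by
        refine lt_of_le_of_lt ?_ hN'
        rw [div_div, div_lt_iff₀ (by positivity)] at h8
        linarith
      exact_mod_cast h9
  obtain ⟨x0, d0, hx0⟩ := hcon
  rw [← hΦ] at hx0
  obtain ⟨⟨x, d⟩, -, hmax⟩ := Finset.exists_max_image (Finset.range N ×ˢ Finset.range N') Φ
    ⟨(x0, d0), hfin _ _ hx0⟩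
  have hM : 0 < Φ (x, d) := lt_of_lt_of_le hx0 (hmax _ (hfin _ _ hx0))
  refine ⟨x, d, Φ (x, d), hM, by rw [hΦ]; ring, fun x' d' => ?_⟩
  have : Φ (x', d') ≤ Φ (x, d) := by
    by_cases hp : 0 < Φ (x', d')
    · exact hmax _ (hfin _ _ hp)
    · exact (not_lt.1 hp).trans hM.le
  rw [hΦ x' d'] at this
  linarith

lemma summable_mul_of_decay (a g : ℕ → ℝ) (K : ℝ) (ha : ∀ j, 0 ≤ a j) (ha0 : a 0 = 0)
    (hs : Summable a) (hg : ∀ w : ℕ, 1 ≤ w → w * |g w| ≤ K) (w : ℕ) :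
    Summable fun j => a j * g (w + j) := by
  refine Summable.of_norm_bounded (hs.mul_right K) fun j => ?_
  rw [norm_mul, Real.norm_of_nonneg (ha j), Real.norm_eq_abs]
  rcases Nat.eq_zero_or_pos (w + j) with h0 | h0
  · have : j = 0 := by omega
    simp [this, ha0]
  · refine mul_le_mul_of_nonneg_left ?_ (ha j)
    have h1 := hg (w + j) h0
    have h2 : (1 : ℝ) ≤ (w + j : ℕ) := by exact_mod_cast h0
    nlinarith [abs_nonneg (g (w + j))]

/-- A maximum principle for the Stein equation with a non-increasing sequence `a`: differences of
the solution at two points are compared with the expected meeting time of two coupled batch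
immigration-death processes. -/
lemma stein_solution_le_of_antitone (a g f : ℕ → ℝ) (m K : ℝ) (D : ℕ) (hD : 1 ≤ D)
    (ha : ∀ j, 0 ≤ a j) (ha0 : a 0 = 0) (hanti : ∀ j, 1 ≤ j → a (j + 1) ≤ a j)
    (hs : Summable a) (hDν : ((D : ℝ) - 1) ^ 2 ≤ a 1 - a 2)
    (hg : ∀ w : ℕ, 1 ≤ w → w * |g w| ≤ K) (hf0 : ∀ w, 0 ≤ f w) (hf1 : ∀ w, f w ≤ 1)
    (heq : ∀ w : ℕ, ∑' j, a j * g (w + j) - w * g w = f w - m) (w : ℕ) (hw : 1 ≤ w) :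
    g w ≤ 2 / D - 1 / (D : ℝ) ^ 2 := by
  have hD0 : (0 : ℝ) < D := by exact_mod_cast hD
  have hK : 0 ≤ K := (mul_nonneg (Nat.cast_nonneg 1) (abs_nonneg _)).trans (hg 1 le_rfl)
  obtain ⟨V, hVlow, hVsuper, hV1⟩ := exists_meeting_time_bound D hD _ hDν
  obtain ⟨ω, hωs, hω0⟩ : ∃ ω : ℕ → ℝ, (∀ d, ω (d + 1) = ω d + V (d + 1)) ∧ ω 0 = 0 :=
    ⟨fun d => ∑ k ∈ Finset.range d, V (k + 1), fun d => Finset.sum_range_succ _ _, by simp⟩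
  obtain ⟨h, hhs⟩ : ∃ h : ℕ → ℝ, ∀ w, h (w + 1) = h w + g (w + 1) :=
    ⟨fun w => ∑ k ∈ Finset.range w, g (k + 1), fun w => Finset.sum_range_succ _ _⟩
  have hωlow : ∀ d : ℕ, (d : ℝ) / D ≤ ω d := by
    intro d
    induction d with
    | zero => simp [hω0]
    | succ d ih =>
      rw [hωs]; push_cast
      have := hVlow (d + 1)
      rw [add_div]; linarith
  -- ω(d) plays the role of a bound on the meeting time of copies started at distance d. The factor
  -- 1 + ε makes the supersolution strict: at a maximal excess, subtracting the equations at x and y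
  -- = x + d would give f y - f x ≤ -(1 + ε), impossible for 0 ≤ f ≤ 1.
  have hmain : ∀ ε : ℝ, 0 < ε → ∀ x d, h (x + d) - h x - (1 + ε) * ω d ≤ 0 := by
    intro ε hε
    by_contra! hcon
    obtain ⟨x, d, M, hM, hMeq, hall⟩ := exists_max_increment h (fun d => (1 + ε) * ω d) K D hD hK
      (fun w => by
        have := hg (w + 1) (by omega)
        push_cast at this
        rwa [hhs, add_sub_cancel_left])
      (fun d => (hωlow d).trans (by
        have : 0 ≤ ω d := le_trans (by positivity) (hωlow d)
        nlinarith)) hcon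
    have hd : d ≠ 0 := by
      rintro rfl
      simp only [hω0, add_zero, mul_zero] at hMeq
      linarith
    obtain ⟨e, rfl⟩ : ∃ e, d = e + 1 := ⟨d - 1, by omega⟩
    obtain ⟨y, hy⟩ : ∃ y, y = x + (e + 1) := ⟨_, rfl⟩
    rw [← hy] at hMeq
    have hgsum := summable_mul_of_decay a g K ha ha0 hs hg
    obtain ⟨u, hu⟩ : ∃ u : ℕ → ℝ, ∀ j, u j = h (y + j) - h (x + j) - (h y - h x) :=
      ⟨_, fun _ => rfl⟩
    have habel : ∑' j, a j * (g (y + j) - g (x + j)) ≤ (a 1 - a 2) * u 1 := by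
      refine tsum_mul_sub_le_of_antitone a _ u ha ha0 hanti (by simp [hu]) (fun j => ?_)
        (fun j => ?_) ?_
      · have := hall (x + j) (e + 1)
        rw [show x + j + (e + 1) = y + j by omega] at this
        rw [hu]; linarith
      · simp only [hu, ← add_assoc, hhs]; ring
      · simpa only [mul_sub] using (hgsum y).sub (hgsum x)
    have htsum : ∑' j, a j * (g (y + j) - g (x + j)) =
        ∑' j, a j * g (y + j) - ∑' j, a j * g (x + j) := by
      rw [← Summable.tsum_sub (hgsum y) (hgsum x)]
      simp only [mul_sub]
    have hν : 0 ≤ a 1 - a 2 := (sq_nonneg _).trans hDν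
    -- Single immigrants are coupled independently: the distance moves to d + 1 or d - 1, and
    -- maximality bounds h at both resulting pairs.
    have hu1 : u 1 ≤ (1 + ε) * (V (e + 1 + 1) - V (e + 1)) := by
      have h1 := hall x (e + 1 + 1)
      rw [show x + (e + 1 + 1) = y + 1 by omega, hωs] at h1
      have h2 := hall (x + 1) e
      rw [show x + 1 + e = y by omega] at h2
      have h3 : ω e = ω (e + 1) - V (e + 1) := by linarith [hωs e]
      rw [h3] at h2
      rw [hu]
      linarith
    -- The death of one of the d extra individuals reduces the distance by one.
    have hgy : - g y ≤ - ((1 + ε) * V (e + 1)) := by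
      have h1 := hall x e
      have h2 := hhs (x + e)
      rw [show x + e + 1 = y by omega] at h2
      rw [hωs] at hMeq
      linarith
    -- Simultaneous deaths in both copies keep the distance.
    have hxg : (x : ℝ) * (g x - g y) ≤ 0 := by
      rcases x with _ | x
      · simp
      · refine mul_nonpos_of_nonneg_of_nonpos (Nat.cast_nonneg _) ?_
        have h1 := hall x (e + 1)
        have h2 := hhs x
        have h3 := hhs (x + (e + 1))
        rw [show x + (e + 1) + 1 = y by omega] at h3
        linarith
    have hyc : (y : ℝ) = x + (e + 1 : ℕ) := by rw [hy]; push_cast; ring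
    have h1 := heq y
    have h2 := heq x
    have h4 := mul_le_mul_of_nonneg_left hu1 hν
    have h5 := mul_le_mul_of_nonneg_left hgy (Nat.cast_nonneg (α := ℝ) (e + 1))
    have h6 := mul_le_mul_of_nonneg_left (hVsuper (e + 1) (by omega))
      (by linarith : (0 : ℝ) ≤ 1 + ε)
    rw [htsum] at habel
    rw [hyc] at h1
    linarith [hf0 y, hf1 x]
  obtain ⟨v, rfl⟩ : ∃ v, w = v + 1 := ⟨w - 1, by omega⟩
  rw [← hV1]
  have hV1pos : 0 < V 1 := lt_of_lt_of_le (by positivity) (hVlow 1)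
  refine le_of_forall_pos_le_add fun ε hε => ?_
  have h1 := hmain (ε / V 1) (by positivity) v 1
  rw [hhs, show ω 1 = V 1 by simpa [hω0] using hωs 0] at h1
  have : ε / V 1 * V 1 = ε := by field_simp
  linarith

/-! ### Size-biasing and the Stein identity of the compound Poisson law. -/

instance isProbabilityMeasure_iidSum (Q : Measure ℕ) [IsProbabilityMeasure Q] (z : ℕ) :
    IsProbabilityMeasure (iidSum Q z) := by
  induction z with
  | zero => exact inferInstanceAs (IsProbabilityMeasure (Measure.dirac 0))
  | succ z ih => exact inferInstanceAs (IsProbabilityMeasure ((iidSum Q z).conv Q))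

instance isProbabilityMeasure_compoundPoisson (l : ℝ≥0) (Q : Measure ℕ) [IsProbabilityMeasure Q] :
    IsProbabilityMeasure (compoundPoisson l Q) := by
  refine ⟨?_⟩
  rw [compoundPoisson, Measure.bind_apply .univ Measurable.of_discrete.aemeasurable]
  simp

/-- The size-biased form of a sum of i.i.d. variables. -/
lemma lintegral_mul_iidSum_succ (Q : Measure ℕ) [IsProbabilityMeasure Q] (z : ℕ) (G : ℕ → ℝ≥0∞) :
    ∫⁻ w, w * G w ∂(iidSum Q (z + 1)) =
      (z + 1 : ℕ) * ∫⁻ w, ∫⁻ j, j * G (w + j) ∂Q ∂(iidSum Q z) := by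
  induction z generalizing G with
  | zero =>
    change ∫⁻ w, w * G w ∂((iidSum Q 0).conv Q) = _
    rw [Measure.lintegral_conv .of_discrete]
    simp [iidSum]
  | succ z ih =>
    -- The weight splits between the first z + 1 summands and the last one; by exchangeability the
    -- first part is z + 1 copies of the second.
    have hsplit : ∫⁻ w, w * G w ∂(iidSum Q (z + 1 + 1)) =
        ∫⁻ x, x * (∫⁻ y, G (x + y) ∂Q) ∂(iidSum Q (z + 1)) +
          ∫⁻ x, ∫⁻ y, y * G (x + y) ∂Q ∂(iidSum Q (z + 1)) := by
      rw [iidSum, Measure.lintegral_conv .of_discrete, ← lintegral_add_left .of_discrete]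
      refine lintegral_congr fun x => ?_
      rw [← lintegral_const_mul _ .of_discrete, ← lintegral_add_left .of_discrete]
      refine lintegral_congr fun y => ?_
      push_cast
      ring
    have hfirst : ∫⁻ x, x * (∫⁻ y, G (x + y) ∂Q) ∂(iidSum Q (z + 1)) =
        (z + 1 : ℕ) * ∫⁻ x, ∫⁻ y, y * G (x + y) ∂Q ∂(iidSum Q (z + 1)) := by
      rw [ih]
      congr 1
      conv_rhs => rw [iidSum, Measure.lintegral_conv .of_discrete]
      refine lintegral_congr fun x => ?_
      rw [lintegral_lintegral_swap Measurable.of_discrete.aemeasurable]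
      refine lintegral_congr fun j => ?_
      rw [← lintegral_const_mul _ .of_discrete]
      refine lintegral_congr fun y => ?_
      rw [add_right_comm]
    rw [hsplit, hfirst]
    push_cast
    ring

/-- The size-biased form of a compound Poisson law. -/
lemma lintegral_mul_compoundPoisson (l : ℝ≥0) (Q : Measure ℕ) [IsProbabilityMeasure Q]
    (G : ℕ → ℝ≥0∞) :
    ∫⁻ w, w * G w ∂(compoundPoisson l Q) =
      l * ∫⁻ w, ∫⁻ j, j * G (w + j) ∂Q ∂(compoundPoisson l Q) := by
  have hbind : ∀ F : ℕ → ℝ≥0∞, ∫⁻ w, F w ∂(compoundPoisson l Q) =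
      ∑' z, (∫⁻ w, F w ∂(iidSum Q z)) * poissonMeasure l {z} := fun F => by
    rw [compoundPoisson, Measure.lintegral_bind Measurable.of_discrete.aemeasurable
      Measurable.of_discrete.aemeasurable, lintegral_countable']
  rw [hbind, hbind, tsum_eq_zero_add' ENNReal.summable, ← ENNReal.tsum_mul_left]
  have h0 : ∫⁻ w, w * G w ∂(iidSum Q 0) = 0 := by simp [iidSum]
  rw [h0, zero_mul, zero_add]
  refine tsum_congr fun z => ?_
  rw [lintegral_mul_iidSum_succ]
  have hpo : ((z + 1 : ℕ) : ℝ≥0∞) * poissonMeasure l {z + 1} = l * poissonMeasure l {z} := by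
    rw [poissonMeasure_singleton, poissonMeasure_singleton, ← ENNReal.ofReal_natCast,
      ← ENNReal.ofReal_coe_nnreal, ← ENNReal.ofReal_mul (by positivity),
      ← ENNReal.ofReal_mul (by positivity)]
    congr 1
    rw [Nat.factorial_succ]
    push_cast
    field_simp
    ring
  calc _ = (∫⁻ w, ∫⁻ j, j * G (w + j) ∂Q ∂(iidSum Q z)) *
        (((z + 1 : ℕ) : ℝ≥0∞) * poissonMeasure l {z + 1}) := by ring
    _ = _ := by rw [hpo]; ring

lemma integrable_mul_comp_add (π Q : Measure ℕ) [IsFiniteMeasure π] [IsFiniteMeasure Q]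
    (hQ : Integrable (fun k : ℕ => (k : ℝ)) Q) (g : ℕ → ℝ) (C : ℝ) (hg : ∀ w, |g w| ≤ C) :
    Integrable (fun z : ℕ × ℕ => (z.2 : ℝ) * g (z.1 + z.2)) (π.prod Q) := by
  refine ((hQ.comp_snd π).mul_const C).mono' (Measurable.of_discrete.aestronglyMeasurable)
    (Filter.Eventually.of_forall fun z => ?_)
  rw [norm_mul, Real.norm_of_nonneg (Nat.cast_nonneg _)]
  exact mul_le_mul_of_nonneg_left (hg _) (Nat.cast_nonneg _)

lemma integrable_integral_mul_comp_add (π Q : Measure ℕ) [IsFiniteMeasure π] [IsFiniteMeasure Q]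
    (hQ : Integrable (fun k : ℕ => (k : ℝ)) Q) (g : ℕ → ℝ) (C : ℝ) (hg : ∀ w, |g w| ≤ C) :
    Integrable (fun w => ∫ j : ℕ, j * g (w + j) ∂Q) π :=
  (integrable_mul_comp_add π Q hQ g C hg).integral_prod_left

lemma integrable_mul_bounded (π : Measure ℕ) (hπ : Integrable (fun k : ℕ => (k : ℝ)) π)
    (g : ℕ → ℝ) (C : ℝ) (hg : ∀ w, |g w| ≤ C) : Integrable (fun w : ℕ => (w : ℝ) * g w) π := by
  refine (hπ.mul_const C).mono' (Measurable.of_discrete.aestronglyMeasurable)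
    (Filter.Eventually.of_forall fun w => ?_)
  rw [norm_mul, Real.norm_of_nonneg (Nat.cast_nonneg _)]
  exact mul_le_mul_of_nonneg_left (hg _) (Nat.cast_nonneg _)

lemma integrable_natCast_compoundPoisson (l : ℝ≥0) (Q : Measure ℕ) [IsProbabilityMeasure Q]
    (hQ : Integrable (fun k : ℕ => (k : ℝ)) Q) :
    Integrable (fun k : ℕ => (k : ℝ)) (compoundPoisson l Q) := by
  refine ⟨Measurable.of_discrete.aestronglyMeasurable, ?_⟩
  have h := lintegral_mul_compoundPoisson l Q (fun _ => 1)
  simp only [mul_one, lintegral_const, measure_univ] at h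
  have h2 : ∫⁻ j : ℕ, (j : ℝ≥0∞) ∂Q < ∞ := by
    have := hQ.2
    rw [hasFiniteIntegral_iff_enorm] at this
    convert this using 2 with k
    funext k
    rw [← ofReal_norm, Real.norm_of_nonneg (Nat.cast_nonneg _), ENNReal.ofReal_natCast]
  rw [hasFiniteIntegral_iff_enorm]
  calc ∫⁻ k : ℕ, ‖(k : ℝ)‖ₑ ∂(compoundPoisson l Q) = ∫⁻ k : ℕ, (k : ℝ≥0∞) ∂(compoundPoisson l Q) := by
        refine lintegral_congr fun k => ?_
        rw [← ofReal_norm, Real.norm_of_nonneg (Nat.cast_nonneg _), ENNReal.ofReal_natCast]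
    _ < ∞ := by rw [h]; exact ENNReal.mul_lt_top ENNReal.coe_lt_top h2

/-- The compound Poisson law is annihilated by its Stein operator. -/
lemma integral_stein_compoundPoisson (l : ℝ≥0) (Q : Measure ℕ) [IsProbabilityMeasure Q]
    (hQ : Integrable (fun k : ℕ => (k : ℝ)) Q) (g : ℕ → ℝ) (C : ℝ) (hg : ∀ w, |g w| ≤ C) :
    ∫ w, (l * ∫ j : ℕ, j * g (w + j) ∂Q - w * g w) ∂(compoundPoisson l Q) = 0 := by
  set π := compoundPoisson l Q with hπ
  have hπi : Integrable (fun k : ℕ => (k : ℝ)) π := integrable_natCast_compoundPoisson l Q hQ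
  have hnn : ∀ (h : ℕ → ℝ) (C : ℝ), (∀ w, |h w| ≤ C) → (∀ w, 0 ≤ h w) →
      ∫ w : ℕ, w * h w ∂π = l * ∫ w, ∫ j : ℕ, j * h (w + j) ∂Q ∂π := by
    intro h C hh h0
    have hF := integrable_mul_comp_add π Q hQ h C hh
    rw [← integral_prod (fun z : ℕ × ℕ => (z.2 : ℝ) * h (z.1 + z.2)) hF,
      integral_eq_lintegral_of_nonneg_ae
        (Filter.Eventually.of_forall fun w => mul_nonneg (Nat.cast_nonneg _) (h0 w))
        Measurable.of_discrete.aestronglyMeasurable,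
      integral_eq_lintegral_of_nonneg_ae
        (Filter.Eventually.of_forall fun w => mul_nonneg (Nat.cast_nonneg _) (h0 _))
        Measurable.of_discrete.aestronglyMeasurable, lintegral_prod _ .of_discrete]
    have h1 := lintegral_mul_compoundPoisson l Q (fun w => ENNReal.ofReal (h w))
    simp only [ENNReal.ofReal_mul (Nat.cast_nonneg _), ENNReal.ofReal_natCast]
    rw [← hπ] at h1
    rw [h1, ENNReal.toReal_mul, ENNReal.coe_toReal]
  have hC : 0 ≤ C := (abs_nonneg _).trans (hg 0)
  -- The lower integral only handles nonnegative functions, so g is shifted by C and the constant's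
  -- contribution is subtracted.
  have e1 := hnn (fun w => g w + C) (2 * C)
    (fun w => by rw [abs_le]; have := abs_le.1 (hg w); constructor <;> linarith)
    (fun w => by have := abs_le.1 (hg w); linarith)
  have e2 := hnn (fun _ => C) C (fun _ => (abs_of_nonneg hC).le) (fun _ => hC)
  have hCb : ∀ w : ℕ, |(fun _ => C : ℕ → ℝ) w| ≤ C := fun _ => (abs_of_nonneg hC).le
  have i1 := integrable_mul_bounded π hπi g C hg
  have i3 := integrable_integral_mul_comp_add π Q hQ g C hg
  have i4 := integrable_integral_mul_comp_add π Q hQ (fun _ => C) C hCb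
  have i5 : ∀ w : ℕ, Integrable (fun j : ℕ => (j : ℝ) * g (w + j)) Q := fun w =>
    integrable_mul_bounded Q hQ (fun j => g (w + j)) C fun j => hg _
  simp only [mul_add] at e1
  rw [integral_add i1 (hπi.mul_const C), e2] at e1
  have e3 : ∀ w : ℕ, ∫ j : ℕ, ((j : ℝ) * g (w + j) + j * C) ∂Q =
      ∫ j : ℕ, (j : ℝ) * g (w + j) ∂Q + ∫ j : ℕ, (j : ℝ) * C ∂Q := fun w =>
    integral_add (i5 w) (hQ.mul_const C)
  simp only [e3] at e1
  rw [integral_add i3 i4, mul_add] at e1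
  rw [integral_sub (i3.const_mul _) i1, integral_const_mul]
  linarith

lemma compoundPoisson_real_zero_pos (l : ℝ≥0) (Q : Measure ℕ) [IsProbabilityMeasure Q] :
    0 < (compoundPoisson l Q).real {0} := by
  rw [measureReal_def]
  refine ENNReal.toReal_pos (fun h => ?_) (measure_ne_top _ _)
  rw [compoundPoisson, Measure.bind_apply (measurableSet_singleton 0)
    Measurable.of_discrete.aemeasurable, lintegral_countable', ENNReal.tsum_eq_zero] at h
  have h0 := h 0
  rw [poissonMeasure_singleton] at h0
  simp only [iidSum, Measure.dirac_apply_of_mem (Set.mem_singleton 0), pow_zero, one_mul,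
    ENNReal.ofReal_eq_zero, Nat.factorial_zero, Nat.cast_one, mul_one, div_one] at h0
  exact absurd h0 (not_le.2 (Real.exp_pos _))

/-! ### The Stein factor bounds the solution. -/

/-- Take D = ⌈√ν⌉, or 1 if that is zero, with ν = 1/δ. Then D - 1 ≤ √ν, and since t(2 - t) increases
on [0,1], D ≥ √ν lets 1/D be replaced by √δ when δ < 1. -/
lemma two_mul_sub_sq_le_steinFactorZero (l : ℝ≥0) (Q : Measure ℕ)
    (hν : 0 ≤ l * (Q.real {1} - 2 * Q.real {2})) :
    ∃ D : ℕ, 1 ≤ D ∧ ((D : ℝ) - 1) ^ 2 ≤ l * (Q.real {1} - 2 * Q.real {2}) ∧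
      ENNReal.ofReal (2 / D - 1 / (D : ℝ) ^ 2) ≤ steinFactorZero l Q := by
  unfold steinFactorZero steinDelta
  generalize (l : ℝ) * (Q.real {1} - 2 * Q.real {2}) = ν at hν ⊢
  refine ⟨max 1 ⌈√ν⌉₊, le_max_left _ _, ?_, ?_⟩
  · rcases Nat.eq_zero_or_pos ⌈√ν⌉₊ with h | h
    · simp [h, hν]
    · have h1 : max 1 ⌈√ν⌉₊ = ⌈√ν⌉₊ := max_eq_right h
      rw [h1]
      have h2 := Nat.ceil_lt_add_one (Real.sqrt_nonneg ν)
      have h3 : (1 : ℝ) ≤ ⌈√ν⌉₊ := by exact_mod_cast h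
      calc ((⌈√ν⌉₊ : ℝ) - 1) ^ 2 ≤ (√ν) ^ 2 := pow_le_pow_left₀ (by linarith) (by linarith) 2
        _ = ν := Real.sq_sqrt hν
  · obtain ⟨D, hDdef⟩ : ∃ D, D = max 1 ⌈√ν⌉₊ := ⟨_, rfl⟩
    rw [← hDdef]
    have hD1 : (1 : ℝ) ≤ D := by rw [hDdef]; exact_mod_cast le_max_left _ _
    have hDν : √ν ≤ D :=
      (Nat.le_ceil _).trans (by rw [hDdef]; exact_mod_cast le_max_right _ _)
    have hinv : 1 / (D : ℝ) ≤ 1 := by rw [div_le_one (by linarith)]; exact hD1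
    have e : 2 / (D : ℝ) - 1 / (D : ℝ) ^ 2 = 2 * (1 / D) - (1 / D) ^ 2 := by ring
    rw [e]
    split_ifs with h
    · rw [ENNReal.ofReal_le_one]
      nlinarith [sq_nonneg (1 - 1 / (D : ℝ))]
    · have hν1 : 1 < ν := by
        by_contra hle
        apply h
        rw [ENNReal.one_le_inv, ENNReal.ofReal_le_one]
        exact not_lt.1 hle
      apply ENNReal.ofReal_le_ofReal
      have hs : √(ENNReal.ofReal ν)⁻¹.toReal = 1 / √ν := by
        rw [ENNReal.toReal_inv, ENNReal.toReal_ofReal hν, Real.sqrt_inv, one_div]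
      rw [hs]
      have hsν : 1 ≤ √ν := Real.one_le_sqrt.2 hν1.le
      have h1 : 1 / (D : ℝ) ≤ 1 / √ν := one_div_le_one_div_of_le (by linarith) hDν
      have h2 : 1 / √ν ≤ 1 := by rw [div_le_one (by linarith)]; exact hsν
      nlinarith [mul_nonneg (sub_nonneg.2 h1) (by linarith : 0 ≤ 2 - 1 / √ν - 1 / (D : ℝ))]

lemma summable_measureReal_mul {ν : Measure ℕ} [IsFiniteMeasure ν] {f : ℕ → ℝ}
    (hf : Integrable f ν) : Summable fun k => ν.real {k} * f k := by
  rw [← Measure.sum_smul_dirac ν, integrable_sum_dirac_iff (fun _ => measure_ne_top _ _)] at hf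
  refine Summable.of_norm_bounded hf fun k => ?_
  rw [norm_mul, Real.norm_of_nonneg measureReal_nonneg, measureReal_def]

lemma integrable_of_bounded (ν : Measure ℕ) [IsFiniteMeasure ν] (f : ℕ → ℝ) (C : ℝ)
    (hf : ∀ w, |f w| ≤ C) : Integrable f ν :=
  (integrable_const C).mono' Measurable.of_discrete.aestronglyMeasurable
    (Filter.Eventually.of_forall hf)

/-- The Stein equation of a compound Poisson law has a solution bounded by the Stein factor. -/
theorem exists_stein_solution_compoundPoisson (l : ℝ≥0) (Q : Measure ℕ) [IsProbabilityMeasure Q]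
    (hQ0 : Q {0} = 0) (hQ : Integrable (fun k : ℕ => (k : ℝ)) Q) (f : ℕ → ℝ)
    (hf0 : ∀ w, 0 ≤ f w) (hf1 : ∀ w, f w ≤ 1) :
    ∃ (g : ℕ → ℝ) (H : ℝ), ENNReal.ofReal H ≤ steinFactor l Q ∧ (∀ w, |g w| ≤ H) ∧
      ∀ w : ℕ, l * ∫ j : ℕ, j * g (w + j) ∂Q - w * g w =
        f w - ∫ k, f k ∂(compoundPoisson l Q) := by
  have hQr0 : Q.real {0} = 0 := by simp [measureReal_def, hQ0]
  set π := compoundPoisson l Q with hπ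
  set m := ∫ k, f k ∂π with hm
  have hfb : ∀ w, |f w| ≤ 1 := fun w => by rw [abs_of_nonneg (hf0 w)]; exact hf1 w
  have hfi : Integrable f π := integrable_of_bounded π f 1 hfb
  have hm0 : 0 ≤ m := integral_nonneg hf0
  have hm1 : m ≤ 1 := by
    have := integral_mono hfi (integrable_const (1 : ℝ)) hf1
    simpa using this
  set c : ℕ → ℝ := fun j => l * Q.real {j} with hc
  have hc0 : ∀ j, 0 ≤ c j := fun j => mul_nonneg l.coe_nonneg measureReal_nonneg
  have hcs : Summable fun j : ℕ => j * c j := by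
    refine ((summable_measureReal_mul hQ).mul_left (l : ℝ)).congr fun j => ?_
    simp only [hc]; ring
  have hcsum : ∑' j, c j = l := by
    have h1 := integral_countable (integrable_const (μ := Q) (1 : ℝ))
    simp only [smul_eq_mul, mul_one, integral_const, probReal_univ] at h1
    simp only [hc, tsum_mul_left, ← h1, mul_one]
  obtain ⟨φ, hφ⟩ := exists_stein_dominating c hc0 (by simp [hc, hQr0]) hcs
  rw [hcsum] at hφ
  set a : ℕ → ℝ := fun j => j * c j with ha
  have ha0 : ∀ j, 0 ≤ a j := fun j => mul_nonneg (Nat.cast_nonneg _) (hc0 j)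
  obtain ⟨g, hgφ, hg0, hgeq⟩ := exists_stein_solution a φ (fun w => f w - m) (Real.exp l) ha0
    (fun w hw => ⟨(hφ w hw).1, (hφ w hw).2.1, (hφ w hw).2.2.1, (hφ w hw).2.2.2.1⟩)
    (fun w => by rw [abs_le]; constructor <;> linarith [hf0 w, hf1 w])
  have hgw : ∀ w : ℕ, 1 ≤ w → w * |g w| ≤ Real.exp l := fun w hw =>
    (mul_le_mul_of_nonneg_left (hgφ w hw) (Nat.cast_nonneg _)).trans (hφ w hw).2.2.2.1
  have hgexp : ∀ w, |g w| ≤ Real.exp l := by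
    intro w
    rcases Nat.eq_zero_or_pos w with rfl | hw
    · rw [hg0, abs_zero]; positivity
    · have h1 : (1 : ℝ) ≤ w := by exact_mod_cast hw
      nlinarith [hgw w hw, abs_nonneg (g w)]
  have hop : ∀ w : ℕ, l * ∫ j : ℕ, j * g (w + j) ∂Q = ∑' j, a j * g (w + j) := by
    intro w
    rw [integral_countable (integrable_mul_bounded Q hQ (fun j => g (w + j)) _ fun j => hgexp _),
      ← tsum_mul_left]
    refine tsum_congr fun j => ?_
    simp only [ha, hc, smul_eq_mul]; ring
  have hzero : ∑' j, a j * g (0 + j) - (0 : ℕ) * g 0 = f 0 - m := by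
    have h1 := integral_stein_compoundPoisson l Q hQ g _ hgexp
    -- The equation was solved only for w ≥ 1. Both sides have mean zero under π, so the defect κ at
    -- 0 satisfies κ π{0} = 0, and π{0} > 0.
    set κ := ∑' j, a j * g (0 + j) - (0 : ℕ) * g 0 - (f 0 - m) with hκ
    have h2 : ∀ w : ℕ, l * ∫ j : ℕ, j * g (w + j) ∂Q - w * g w =
        (f w - m) + Set.indicator {0} (fun _ => κ) w := by
      intro w
      rw [hop]
      rcases Nat.eq_zero_or_pos w with rfl | hw
      · rw [Set.indicator_of_mem (Set.mem_singleton 0), hκ]; ring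
      · rw [Set.indicator_of_notMem (by simpa using hw.ne'), hgeq w hw, add_zero]
    simp only [h2] at h1
    have hfm : Integrable (fun w => f w - m) π := hfi.sub (integrable_const m)
    rw [← hπ, integral_add hfm
      ((integrable_const κ).indicator (measurableSet_singleton 0)),
      integral_sub hfi (integrable_const m), integral_indicator_const _ (measurableSet_singleton 0)]
      at h1
    simp only [integral_const, probReal_univ, smul_eq_mul, one_mul, ← hm, sub_self, zero_add] at h1
    rcases mul_eq_zero.1 h1 with h | h
    · exact absurd h (compoundPoisson_real_zero_pos l Q).ne'
    · linarith
  have heq : ∀ w : ℕ, ∑' j, a j * g (w + j) - w * g w = f w - m := by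
    intro w
    rcases Nat.eq_zero_or_pos w with rfl | hw
    · exact hzero
    · exact hgeq w hw
  suffices h : ∃ H : ℝ, ENNReal.ofReal H ≤ steinFactor l Q ∧ ∀ w, 1 ≤ w → |g w| ≤ H by
    obtain ⟨H, hH, hb⟩ := h
    refine ⟨g, H, hH, fun w => ?_, fun w => by rw [hop, heq]⟩
    rcases Nat.eq_zero_or_pos w with rfl | hw
    · rw [hg0, abs_zero]
      exact (abs_nonneg _).trans (hb 1 le_rfl)
    · exact hb w hw
  unfold steinFactor
  split_ifs with hanti
  · have hanti' : ∀ j, 1 ≤ j → a (j + 1) ≤ a j := by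
      intro j hj
      have := hanti (Set.mem_Ici.2 hj) (Set.mem_Ici.2 (by omega : 1 ≤ j + 1)) (Nat.le_succ j)
      have := mul_le_mul_of_nonneg_left this l.coe_nonneg
      simp only [ha, hc]
      simp only at this
      linarith
    have hν : a 1 - a 2 = l * (Q.real {1} - 2 * Q.real {2}) := by
      simp only [ha, hc]; push_cast; ring
    obtain ⟨D, hD, hDν, hDH⟩ := two_mul_sub_sq_le_steinFactorZero l Q (by
      rw [← hν]; linarith [hanti' 1 le_rfl])
    refine ⟨_, hDH, fun w hw => ?_⟩
    rw [← hν] at hDν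
    rw [abs_le', ← Pi.neg_apply]
    refine ⟨stein_solution_le_of_antitone a g f m _ D hD ha0 (by simp [ha]) hanti' hcs hDν hgw
      hf0 hf1 heq w hw, ?_⟩
    -- The lower bound follows by symmetry: -g solves the equation for 1 - f.
    refine stein_solution_le_of_antitone a (-g) (fun w => 1 - f w) (1 - m) _ D hD ha0 (by simp [ha])
      hanti' hcs hDν (by simpa using hgw) (fun w => by linarith [hf1 w])
      (fun w => by linarith [hf0 w]) (fun w => ?_) w hw
    simp only [Pi.neg_apply, mul_neg, tsum_neg]
    linarith [heq w]
  · have hc1 : (l : ℝ) * Q.real {1} = c 1 := rfl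
    rw [hc1]
    rcases le_or_gt (c 1) 1 with h | h
    · refine ⟨Real.exp l, ?_, fun w _ => hgexp w⟩
      rw [min_eq_left, mul_one]
      rw [ENNReal.one_le_inv, ENNReal.ofReal_le_one]
      exact h
    · have hpos : 0 < c 1 := by linarith
      refine ⟨Real.exp l * (c 1)⁻¹, ?_, fun w hw => ?_⟩
      · rw [min_eq_right, ENNReal.ofReal_mul (Real.exp_pos _).le, ENNReal.ofReal_inv_of_pos hpos]
        rw [ENNReal.inv_le_one, ENNReal.one_le_ofReal]
        exact h.le
      · have h1 := (hφ w hw).2.2.2.2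
        rw [← div_eq_mul_inv, le_div_iff₀ hpos]
        nlinarith [hgφ w hw]

/-! ### Bernoulli mixtures and their scores. -/

/-- The law of `B X` for independent `B ∼ Bern(p)` and `X ∼ q`. -/
noncomputable def bernoulliMixture (p : ℝ) (q : Measure ℕ) : Measure ℕ :=
  ENNReal.ofReal (1 - p) • Measure.dirac 0 + ENNReal.ofReal p • q

/-- The score of `bernoulliMixture p q` with respect to the Stein operator of the compound Poisson
law with parameters `p` and `q`. -/
noncomputable def bernoulliScore (p : ℝ) (q : Measure ℕ) (y : ℕ) : ℝ :=
  p * (y * ((q.conv q).real {y} / (2 * q.real {y}) - 1))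

lemma bernoulliScore_zero (p : ℝ) (q : Measure ℕ) : bernoulliScore p q 0 = 0 := by
  simp [bernoulliScore]

lemma map_mul_eq_bernoulliMixture {Ω : Type*} [MeasurableSpace Ω] (μ : Measure Ω)
    [IsProbabilityMeasure μ] (B X : Ω → ℕ) (p : unitInterval)
    (hB : HasLaw B (bernoulliMeasure 1 0 p) μ) (q : Measure ℕ) (hX : HasLaw X q μ)
    (hBX : IndepFun B X μ) :
    μ.map (fun ω => B ω * X ω) = bernoulliMixture p q := by
  have : IsProbabilityMeasure q := hX.map_eq ▸ Measure.isProbabilityMeasure_map hX.aemeasurable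
  have h1 := (indepFun_iff_map_prod_eq_prod_map_map hB.aemeasurable hX.aemeasurable).1 hBX
  have h2 : μ.map (fun ω => B ω * X ω) =
      (μ.map (fun ω => (B ω, X ω))).map (fun z : ℕ × ℕ => z.1 * z.2) := by
    rw [AEMeasurable.map_map_of_aemeasurable Measurable.of_discrete.aemeasurable
      (hB.aemeasurable.prodMk hX.aemeasurable)]
    rfl
  have e1 : ENNReal.ofReal (p : ℝ) = (unitInterval.toNNReal p : ℝ≥0∞) :=
    ENNReal.ofReal_eq_coe_nnreal p.2.1
  have e2 : ENNReal.ofReal (1 - (p : ℝ)) =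
      (unitInterval.toNNReal (unitInterval.symm p) : ℝ≥0∞) :=
    ENNReal.ofReal_eq_coe_nnreal (sub_nonneg.2 p.2.2)
  have h3 : bernoulliMeasure (1 : ℕ) 0 p =
      ENNReal.ofReal (p : ℝ) • Measure.dirac 1 + ENNReal.ofReal (1 - (p : ℝ)) • Measure.dirac 0 := by
    rw [e1, e2]; rfl
  rw [h2, h1, hB.map_eq, hX.map_eq, h3, Measure.add_prod, Measure.prod_smul_left,
    Measure.prod_smul_left, Measure.dirac_prod, Measure.dirac_prod,
    Measure.map_add _ _ .of_discrete, Measure.map_smul, Measure.map_smul,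
    Measure.map_map .of_discrete .of_discrete, Measure.map_map .of_discrete .of_discrete,
    bernoulliMixture, add_comm]
  congr 2
  · have : (fun z : ℕ × ℕ => z.1 * z.2) ∘ Prod.mk 0 = fun _ => 0 := by funext x; simp
    rw [this, Measure.map_const, measure_univ, one_smul]
  · have : (fun z : ℕ × ℕ => z.1 * z.2) ∘ Prod.mk 1 = id := by funext x; simp
    rw [this, Measure.map_id]

lemma integral_bernoulliMixture (p : ℝ) (hp0 : 0 ≤ p) (hp1 : p ≤ 1) (q : Measure ℕ)
    [IsFiniteMeasure q] (F : ℕ → ℝ) (hF : Integrable F q) :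
    Integrable F (bernoulliMixture p q) ∧
      ∫ y, F y ∂(bernoulliMixture p q) = (1 - p) * F 0 + p * ∫ y, F y ∂q := by
  have h1 : Integrable F (ENNReal.ofReal (1 - p) • Measure.dirac 0) :=
    (integrable_dirac (by simp)).smul_measure ENNReal.ofReal_ne_top
  have h2 : Integrable F (ENNReal.ofReal p • q) := hF.smul_measure ENNReal.ofReal_ne_top
  refine ⟨h1.add_measure h2, ?_⟩
  rw [bernoulliMixture, integral_add_measure h1 h2, integral_smul_measure, integral_smul_measure,
    integral_dirac, ENNReal.toReal_ofReal (by linarith), ENNReal.toReal_ofReal hp0]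
  simp

lemma integrable_of_summable {ν : Measure ℕ} [IsFiniteMeasure ν] {f : ℕ → ℝ}
    (hf : Summable fun k => ν.real {k} * f k) : Integrable f ν := by
  rw [← Measure.sum_smul_dirac ν, integrable_sum_dirac_iff (fun _ => measure_ne_top _ _)]
  refine hf.norm.congr fun k => ?_
  rw [norm_mul, Real.norm_of_nonneg measureReal_nonneg, measureReal_def]

lemma integrable_natCast_conv (q : Measure ℕ) [IsProbabilityMeasure q]
    (hq : Integrable (fun k : ℕ => (k : ℝ)) q) :
    Integrable (fun k : ℕ => (k : ℝ)) (q.conv q) := by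
  rw [Measure.conv, integrable_map_measure Measurable.of_discrete.aestronglyMeasurable
    Measurable.of_discrete.aemeasurable]
  refine ((hq.comp_fst q).add (hq.comp_snd q)).congr (Filter.Eventually.of_forall fun z => ?_)
  simp

/-- Writing k as the sum of the two coordinates, both halves agree because q × q is symmetric. -/
lemma integral_mul_conv_self (q : Measure ℕ) [IsProbabilityMeasure q]
    (hq : Integrable (fun k : ℕ => (k : ℝ)) q) (G : ℕ → ℝ) (C : ℝ) (hG : ∀ w, |G w| ≤ C) :
    ∫ k : ℕ, k * G k ∂(q.conv q) = 2 * ∫ y, ∫ j : ℕ, j * G (y + j) ∂q ∂q := by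
  have h1 := integrable_mul_comp_add q q hq G C hG
  have h2 : Integrable (fun z : ℕ × ℕ => (z.1 : ℝ) * G (z.1 + z.2)) (q.prod q) := by
    refine h1.swap.congr (Filter.Eventually.of_forall fun z => ?_)
    simp [add_comm]
  have h3 : ∫ z, (z.1 : ℝ) * G (z.1 + z.2) ∂(q.prod q) =
      ∫ z, (z.2 : ℝ) * G (z.1 + z.2) ∂(q.prod q) := by
    rw [← integral_prod_swap]
    refine integral_congr_ae (Filter.Eventually.of_forall fun z => ?_)
    simp [add_comm]
  rw [Measure.conv, integral_map Measurable.of_discrete.aemeasurable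
    Measurable.of_discrete.aestronglyMeasurable]
  have h4 : ∀ z : ℕ × ℕ, ((z.1 + z.2 : ℕ) : ℝ) * G (z.1 + z.2) =
      (z.1 : ℝ) * G (z.1 + z.2) + (z.2 : ℝ) * G (z.1 + z.2) := fun z => by push_cast; ring
  simp only [h4]
  rw [integral_add h2 h1, h3, integral_prod _ h1]
  ring

/-- Integrating against q cancels the denominator q(y), which is where full support enters; at y = 0
the factor y removes the division by zero. What remains is half the first-moment integral over q *
q. -/
lemma integrable_bernoulliScore (p : ℝ) (q : Measure ℕ) [IsProbabilityMeasure q]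
    (hsupp : ∀ k : ℕ, 1 ≤ k → 0 < q {k}) (hq : Integrable (fun k : ℕ => (k : ℝ)) q) (G : ℕ → ℝ)
    (C : ℝ) (hG : ∀ w, |G w| ≤ C) :
    Integrable (fun y => bernoulliScore p q y * G y) q ∧
      ∫ y, bernoulliScore p q y * G y ∂q =
        p * (∫ y, ∫ j : ℕ, j * G (y + j) ∂q ∂q - ∫ y : ℕ, y * G y ∂q) := by
  have hc := integrable_mul_bounded _ (integrable_natCast_conv q hq) G C hG
  have hq' := integrable_mul_bounded _ hq G C hG
  have e : ∀ k : ℕ, q.real {k} * (k * ((q.conv q).real {k} / (2 * q.real {k})) * G k) =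
      (q.conv q).real {k} * (k * G k) / 2 := by
    intro k
    rcases Nat.eq_zero_or_pos k with rfl | hk
    · simp
    · have : q.real {k} ≠ 0 := by
        rw [measureReal_def]
        exact (ENNReal.toReal_pos (hsupp k hk).ne' (measure_ne_top _ _)).ne'
      field_simp
  have hi : Integrable (fun k : ℕ => k * ((q.conv q).real {k} / (2 * q.real {k})) * G k) q := by
    apply integrable_of_summable
    simp only [e]
    exact (summable_measureReal_mul hc).div_const 2
  have hsc : ∀ y : ℕ, bernoulliScore p q y * G y =
      p * (y * ((q.conv q).real {y} / (2 * q.real {y})) * G y - y * G y) := fun y => by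
    simp only [bernoulliScore]; ring
  simp only [hsc]
  refine ⟨(hi.sub hq').const_mul p, ?_⟩
  rw [integral_const_mul, integral_sub hi hq', integral_countable hi]
  simp only [smul_eq_mul, e]
  have h1 := integral_mul_conv_self q hq G C hG
  rw [integral_countable hc] at h1
  simp only [smul_eq_mul] at h1
  rw [tsum_div_const, h1]
  ring

/-- The Stein operator of a compound Poisson law, integrated against a Bernoulli mixture. -/
lemma integral_stein_bernoulliMixture (p : ℝ) (hp0 : 0 ≤ p) (hp1 : p ≤ 1) (q : Measure ℕ)
    [IsProbabilityMeasure q] (hsupp : ∀ k : ℕ, 1 ≤ k → 0 < q {k})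
    (hq : Integrable (fun k : ℕ => (k : ℝ)) q) (G : ℕ → ℝ) (C : ℝ) (hG : ∀ w, |G w| ≤ C) :
    ∫ y, (p * ∫ j : ℕ, j * G (y + j) ∂q - y * G y) ∂(bernoulliMixture p q) =
      ∫ y, bernoulliScore p q y * G y ∂(bernoulliMixture p q) := by
  have h1 := integrable_bernoulliScore p q hsupp hq G C hG
  have h2 := (integrable_integral_mul_comp_add q q hq G C hG).const_mul p
  have h3 := integrable_mul_bounded q hq G C hG
  have h4 : Integrable (fun y : ℕ => p * ∫ j : ℕ, j * G (y + j) ∂q - y * G y) q := h2.sub h3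
  -- The atom at 0 gives p(1-p)∫ jG dq, which combines with -p∫ yG dq into -p²∫ yG dq.
  rw [(integral_bernoulliMixture p hp0 hp1 q _ h4).2,
    (integral_bernoulliMixture p hp0 hp1 q _ h1.1).2, h1.2, integral_sub h2 h3, integral_const_mul,
    bernoulliScore_zero]
  simp only [zero_add, Nat.cast_zero, zero_mul, sub_zero, mul_zero]
  ring

lemma lintegral_bernoulliScore_sq (p : ℝ) (hp0 : 0 ≤ p) (q : Measure ℕ) [IsFiniteMeasure q] :
    ∫⁻ y, ENNReal.ofReal (bernoulliScore p q y ^ 2) ∂(bernoulliMixture p q) =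
      ENNReal.ofReal (p ^ 3) * convDefect q := by
  rw [bernoulliMixture, lintegral_add_measure, lintegral_smul_measure, lintegral_smul_measure,
    lintegral_dirac, bernoulliScore_zero, lintegral_countable', convDefect]
  simp only [ne_eq, OfNat.ofNat_ne_zero, not_false_eq_true, zero_pow, ENNReal.ofReal_zero,
    smul_eq_mul, mul_zero, zero_add]
  rw [← ENNReal.tsum_mul_left, ← ENNReal.tsum_mul_left]
  refine tsum_congr fun y => ?_
  rw [← ofReal_measureReal (measure_ne_top q {y}), ← ENNReal.ofReal_mul (by positivity),
    ← ENNReal.ofReal_mul hp0, ← ENNReal.ofReal_mul (by positivity)]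
  congr 1
  simp only [bernoulliScore]
  ring

/-- The Stein identity for one summand `Y` of a sum `Y + T` of independent variables. -/
lemma integral_stein_summand {Ω : Type*} [MeasurableSpace Ω] (μ : Measure Ω)
    [IsProbabilityMeasure μ] (Y T : Ω → ℕ) (hY : AEMeasurable Y μ) (hT : AEMeasurable T μ)
    (hYT : IndepFun Y T μ) (p : ℝ) (hp0 : 0 ≤ p) (hp1 : p ≤ 1) (q : Measure ℕ)
    [IsProbabilityMeasure q] (hlaw : μ.map Y = bernoulliMixture p q)
    (hsupp : ∀ k : ℕ, 1 ≤ k → 0 < q {k})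
    (hq : Integrable (fun k : ℕ => (k : ℝ)) q) (g : ℕ → ℝ) (C : ℝ) (hg : ∀ w, |g w| ≤ C) :
    Integrable (fun ω => p * ∫ j : ℕ, j * g (Y ω + T ω + j) ∂q - Y ω * g (Y ω + T ω)) μ ∧
    Integrable (fun ω => bernoulliScore p q (Y ω) * g (Y ω + T ω)) μ ∧
    ∫ ω, (p * ∫ j : ℕ, j * g (Y ω + T ω + j) ∂q - Y ω * g (Y ω + T ω)) ∂μ =
      ∫ ω, bernoulliScore p q (Y ω) * g (Y ω + T ω) ∂μ := by
  have hprod := (indepFun_iff_map_prod_eq_prod_map_map hY hT).1 hYT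
  have hpm := hY.prodMk hT
  have : IsProbabilityMeasure (μ.map Y) := Measure.isProbabilityMeasure_map hY
  have : IsProbabilityMeasure (μ.map T) := Measure.isProbabilityMeasure_map hT
  have hC : 0 ≤ C := (abs_nonneg _).trans (hg 0)
  set F : ℕ × ℕ → ℝ := fun z => p * ∫ j : ℕ, j * g (z.1 + z.2 + j) ∂q - z.1 * g (z.1 + z.2) with hF
  set R : ℕ × ℕ → ℝ := fun z => bernoulliScore p q z.1 * g (z.1 + z.2) with hR
  have hid : Integrable (fun k : ℕ => (k : ℝ)) (μ.map Y) := by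
    rw [hlaw]; exact (integral_bernoulliMixture p hp0 hp1 q _ hq).1
  have hsc : Integrable (bernoulliScore p q) (μ.map Y) := by
    have := (integrable_bernoulliScore p q hsupp hq (fun _ => 1) 1 (by simp)).1
    simp only [mul_one] at this
    rw [hlaw]; exact (integral_bernoulliMixture p hp0 hp1 q _ this).1
  have hFi : Integrable F ((μ.map Y).prod (μ.map T)) := by
    refine Integrable.sub (Integrable.const_mul ?_ _) ?_
    · refine (integrable_const (∫ j : ℕ, (j : ℝ) * C ∂q)).mono'
        Measurable.of_discrete.aestronglyMeasurable (Filter.Eventually.of_forall fun z => ?_)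
      refine norm_integral_le_of_norm_le (hq.mul_const C) (Filter.Eventually.of_forall fun j => ?_)
      rw [norm_mul, Real.norm_of_nonneg (Nat.cast_nonneg _)]
      exact mul_le_mul_of_nonneg_left (hg _) (Nat.cast_nonneg _)
    · refine ((hid.comp_fst (μ.map T)).mul_const C).mono'
        Measurable.of_discrete.aestronglyMeasurable (Filter.Eventually.of_forall fun z => ?_)
      rw [norm_mul, Real.norm_of_nonneg (Nat.cast_nonneg _)]
      exact mul_le_mul_of_nonneg_left (hg _) (Nat.cast_nonneg _)
  have hRi : Integrable R ((μ.map Y).prod (μ.map T)) := by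
    refine ((hsc.norm.comp_fst (μ.map T)).mul_const C).mono'
        Measurable.of_discrete.aestronglyMeasurable (Filter.Eventually.of_forall fun z => ?_)
    rw [norm_mul]
    exact mul_le_mul_of_nonneg_left (hg _) (norm_nonneg _)
  have hmeas : ∀ F : ℕ × ℕ → ℝ,
      AEStronglyMeasurable F (μ.map fun ω => (Y ω, T ω)) := fun F =>
    Measurable.of_discrete.aestronglyMeasurable
  refine ⟨?_, ?_, ?_⟩
  · have := hFi
    rw [← hprod, integrable_map_measure (hmeas F) hpm] at this
    exact this
  · have := hRi
    rw [← hprod, integrable_map_measure (hmeas R) hpm] at this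
    exact this
  · have e1 := integral_map hpm (hmeas F)
    have e2 := integral_map hpm (hmeas R)
    refine e1.symm.trans (Eq.trans ?_ e2)
    -- Condition on T = t and use the one-variable identity for g(· + t).
    rw [hprod, integral_prod_symm _ hFi, integral_prod_symm _ hRi]
    refine integral_congr_ae (Filter.Eventually.of_forall fun t => ?_)
    have := integral_stein_bernoulliMixture p hp0 hp1 q hsupp hq (fun y => g (y + t)) C
      (fun w => hg _)
    rw [← hlaw] at this
    simp only [hF, hR]
    rw [← this]
    simp only [add_right_comm]

/-! ### Total variation, the second moment bound and the conclusion. -/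

/-- The indicator of {ν < P} picks out the positive part of P - ν, which carries half of the
absolute mass since the total masses agree. -/
lemma exists_tvDist_eq (P ν : Measure ℕ) [IsProbabilityMeasure P] [IsProbabilityMeasure ν] :
    ∃ f : ℕ → ℝ, (∀ w, 0 ≤ f w) ∧ (∀ w, f w ≤ 1) ∧
      tvDist P ν = ∫ k, f k ∂P - ∫ k, f k ∂ν := by
  classical
  have hind : ∀ w : ℕ, 0 ≤ (if ν.real {w} < P.real {w} then (1 : ℝ) else 0) ∧
      (if ν.real {w} < P.real {w} then (1 : ℝ) else 0) ≤ 1 := fun w => by split_ifs <;> simp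
  refine ⟨fun w => if ν.real {w} < P.real {w} then 1 else 0, fun w => (hind w).1,
    fun w => (hind w).2, ?_⟩
  set f : ℕ → ℝ := fun w => if ν.real {w} < P.real {w} then 1 else 0 with hf
  have hfb : ∀ w, |f w| ≤ 1 := fun w => by rw [abs_of_nonneg (hind w).1]; exact (hind w).2
  have hs : ∀ (ρ : Measure ℕ) [IsProbabilityMeasure ρ], Summable (fun k => ρ.real {k} * f k) ∧
      ∫ k, f k ∂ρ = ∑' k, ρ.real {k} * f k ∧ Summable (fun k => ρ.real {k}) ∧
      ∑' k, ρ.real {k} = 1 := by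
    intro ρ _
    have hi := integrable_of_bounded ρ f 1 hfb
    refine ⟨summable_measureReal_mul hi, integral_countable hi, ?_, ?_⟩
    · simpa using summable_measureReal_mul (integrable_const (μ := ρ) (1 : ℝ))
    · have := integral_countable (integrable_const (μ := ρ) (1 : ℝ))
      simpa using this.symm
  obtain ⟨p1, p2, p3, p4⟩ := hs P
  obtain ⟨r1, r2, r3, r4⟩ := hs ν
  have habs : ∀ k, |P.real {k} - ν.real {k}| =
      2 * (P.real {k} * f k - ν.real {k} * f k) - (P.real {k} - ν.real {k}) := by
    intro k
    simp only [hf]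
    split_ifs with h
    · rw [abs_of_pos (sub_pos.2 h)]; ring
    · rw [abs_of_nonpos (sub_nonpos.2 (not_lt.1 h))]; ring
  rw [tvDist, p2, r2]
  simp only [habs]
  rw [((p1.sub r1).mul_left 2).tsum_sub (p3.sub r3), tsum_mul_left, p1.tsum_sub r1,
    p3.tsum_sub r3, p4, r4]
  ring

/-- This excludes the convention 0 · ∞ = 0 when the variance sum is infinite, so that the bound is
then trivial. -/
lemma steinFactor_ne_zero (l : ℝ≥0) (Q : Measure ℕ) : steinFactor l Q ≠ 0 := by
  unfold steinFactor
  split_ifs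
  · unfold steinFactorZero
    split_ifs with h
    · exact one_ne_zero
    · rw [not_le] at h
      have h0 : 0 < (steinDelta l Q).toReal :=
        ENNReal.toReal_pos (ENNReal.inv_ne_zero.2 ENNReal.ofReal_ne_top) h.ne_top
      have h1 : (steinDelta l Q).toReal ≤ 1 := ENNReal.toReal_le_of_le_ofReal zero_le_one (by
        simpa using h.le)
      have h2 := Real.sqrt_pos.2 h0
      have h3 := Real.sqrt_le_one.2 h1
      exact (ENNReal.ofReal_pos.2 (mul_pos h2 (by linarith))).ne'
  · refine mul_ne_zero (ENNReal.ofReal_pos.2 (Real.exp_pos _)).ne' ?_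
    exact (lt_min one_pos (ENNReal.inv_pos.2 ENNReal.ofReal_ne_top)).ne'

/-- The first absolute moment of a sum of centred independent square-integrable variables. -/
lemma ofReal_integral_abs_sum_le {Ω : Type*} [MeasurableSpace Ω] (μ : Measure Ω)
    [IsProbabilityMeasure μ] {n : ℕ} (R : Fin n → Ω → ℝ) (hR : ∀ i, MemLp (R i) 2 μ)
    (hmean : ∀ i, ∫ ω, R i ω ∂μ = 0) (hind : iIndepFun R μ) :
    ENNReal.ofReal (∫ ω, |∑ i, R i ω| ∂μ) ≤
      (∑ i, ∫⁻ ω, ENNReal.ofReal (R i ω ^ 2) ∂μ) ^ (1 / 2 : ℝ) := by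
  have hsum : MemLp (∑ i, R i) 2 μ := memLp_finsetSum' _ fun i _ => hR i
  have hsi : ∫ ω, (∑ i, R i) ω ∂μ = 0 := by
    simp only [Finset.sum_apply]
    rw [integral_finsetSum _ fun i _ => (hR i).integrable one_le_two]
    simp [hmean]
  have hvar := IndepFun.variance_sum (s := Finset.univ) (fun i _ => hR i)
    (fun i _ j _ hij => hind.indepFun hij)
  have h1 := variance_eq_sub hsum
  have h2 := variance_nonneg (fun ω => |(∑ i, R i) ω|) μ
  -- Nonnegativity of the variance of |∑ R_i| is the Cauchy–Schwarz inequality needed here.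
  rw [variance_eq_sub (X := fun ω => |(∑ i, R i) ω|) hsum.abs] at h2
  rw [hsi] at h1
  have h3 : ∀ i, Var[R i; μ] = ∫ ω, R i ω ^ 2 ∂μ := fun i => by
    rw [variance_eq_sub (hR i), hmean i]; simp
  simp only [Pi.pow_apply, sq_abs] at h1 h2
  have h4 : (∫ ω, |∑ i, R i ω| ∂μ) ^ 2 ≤ ∑ i, ∫ ω, R i ω ^ 2 ∂μ := by
    simp only [← h3, ← hvar, h1]
    simp only [Finset.sum_apply] at h2 ⊢
    linarith
  rw [one_div, ENNReal.le_rpow_inv_iff two_pos, ENNReal.rpow_two,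
    ← ENNReal.ofReal_pow (integral_nonneg fun ω => abs_nonneg _)]
  refine (ENNReal.ofReal_le_ofReal h4).trans ?_
  rw [ENNReal.ofReal_sum_of_nonneg fun i _ => integral_nonneg fun ω => sq_nonneg _]
  refine Finset.sum_le_sum fun i _ => ?_
  rw [ofReal_integral_eq_lintegral_ofReal (hR i).integrable_sq
    (Filter.Eventually.of_forall fun ω => sq_nonneg _)]

lemma isProbabilityMeasure_weighted_sum {n : ℕ} (p : Fin n → ℝ) (hp : ∀ i, 0 ≤ p i)
    (q : Fin n → Measure ℕ) [∀ i, IsProbabilityMeasure (q i)] (l : ℝ) (hl : l = ∑ i, p i)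
    (hl_pos : 0 < l) : IsProbabilityMeasure (∑ i, ENNReal.ofReal (p i / l) • q i) := by
  refine ⟨?_⟩
  rw [Measure.finsetSum_apply]
  simp only [Measure.smul_apply, measure_univ, smul_eq_mul, mul_one]
  rw [← ENNReal.ofReal_sum_of_nonneg fun i _ => div_nonneg (hp i) hl_pos.le, ← Finset.sum_div,
    ← hl, div_self hl_pos.ne', ENNReal.ofReal_one]

lemma integral_weighted_sum {n : ℕ} (p : Fin n → ℝ) (hp : ∀ i, 0 ≤ p i)
    (q : Fin n → Measure ℕ) (l : ℝ) (hl_pos : 0 < l) (F : ℕ → ℝ) (hF : ∀ i, Integrable F (q i)) :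
    Integrable F (∑ i, ENNReal.ofReal (p i / l) • q i) ∧
      l * ∫ k, F k ∂(∑ i, ENNReal.ofReal (p i / l) • q i) = ∑ i, p i * ∫ k, F k ∂(q i) := by
  have h1 : ∀ i, Integrable F (ENNReal.ofReal (p i / l) • q i) := fun i =>
    (hF i).smul_measure ENNReal.ofReal_ne_top
  refine ⟨integrable_finsetSum_measure.2 fun i _ => h1 i, ?_⟩
  rw [integral_finsetSum_measure fun i _ => h1 i, Finset.mul_sum]
  refine Finset.sum_congr rfl fun i _ => ?_
  rw [integral_smul_measure, ENNReal.toReal_ofReal (div_nonneg (hp i) hl_pos.le), smul_eq_mul]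
  field_simp

theorem theorem3 {Ω : Type*} [MeasurableSpace Ω] (μ : Measure Ω) [IsProbabilityMeasure μ]
    (n : ℕ) (B X : Fin n → Ω → ℕ)
    -- `B i` is Bernoulli with parameter `p i`
    (p : Fin n → unitInterval)
    (hB : ∀ i, HasLaw (B i) (bernoulliMeasure 1 0 (p i)) μ)
    -- `X i` has law `q i`, a distribution on `{1, 2, …}` with full support and finite mean
    (q : Fin n → Measure ℕ) (hX : ∀ i, HasLaw (X i) (q i) μ)
    (hq_zero : ∀ i, q i {0} = 0)
    (hq_supp : ∀ i, ∀ k : ℕ, 1 ≤ k → 0 < q i {k})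
    (hq_mean : ∀ i, Integrable (fun k : ℕ => (k : ℝ)) (q i))
    -- `B i` and `X i` are independent, and the products `B i * X i` are mutually independent
    (hBX : ∀ i, IndepFun (B i) (X i) μ)
    (hY : iIndepFun (fun i ω => B i ω * X i ω) μ)
    (l : ℝ≥0) (hl : (l : ℝ) = ∑ i, (p i : ℝ)) (hl_pos : 0 < l)
    (Q : Measure ℕ) (hQ : Q = ∑ i, ENNReal.ofReal ((p i : ℝ) / l) • q i) :
    ENNReal.ofReal (tvDist (μ.map (fun ω => ∑ i, B i ω * X i ω)) (compoundPoisson l Q)) ≤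
      steinFactor l Q *
        (∑ i, ENNReal.ofReal ((p i : ℝ) ^ 3) * convDefect (q i)) ^ (1 / 2 : ℝ) := by
  have hqp : ∀ i, IsProbabilityMeasure (q i) := fun i =>
    (hX i).map_eq ▸ Measure.isProbabilityMeasure_map (hX i).aemeasurable
  have hp0 : ∀ i, (0 : ℝ) ≤ p i := fun i => (p i).2.1
  have hp1 : ∀ i, (p i : ℝ) ≤ 1 := fun i => (p i).2.2
  by_cases hfin : ∑ i, ENNReal.ofReal ((p i : ℝ) ^ 3) * convDefect (q i) = ∞
  · rw [hfin, ENNReal.top_rpow_of_pos (by norm_num), ENNReal.mul_top (steinFactor_ne_zero l Q)]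
    exact le_top
  have hQp : IsProbabilityMeasure Q := hQ ▸ isProbabilityMeasure_weighted_sum _ hp0 q l hl hl_pos
  have hQ0 : Q {0} = 0 := by simp [hQ, Measure.finsetSum_apply, hq_zero]
  have hQm : Integrable (fun k : ℕ => (k : ℝ)) Q := by
    rw [hQ]; exact (integral_weighted_sum _ hp0 q l hl_pos _ hq_mean).1
  set Y : Fin n → Ω → ℕ := fun i ω => B i ω * X i ω with hYdef
  have hYm : ∀ i, AEMeasurable (Y i) μ := fun i =>
    (hB i).aemeasurable.mul (hX i).aemeasurable
  have hSm : AEMeasurable (fun ω => ∑ i, Y i ω) μ :=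
    Finset.aemeasurable_fun_sum _ fun i _ => hYm i
  have hlaw : ∀ i, μ.map (Y i) = bernoulliMixture (p i) (q i) := fun i =>
    map_mul_eq_bernoulliMixture μ (B i) (X i) (p i) (hB i) (q i) (hX i) (hBX i)
  have : IsProbabilityMeasure (μ.map (fun ω => ∑ i, Y i ω)) :=
    Measure.isProbabilityMeasure_map hSm
  obtain ⟨f, hf0, hf1, htv⟩ := exists_tvDist_eq (μ.map (fun ω => ∑ i, Y i ω)) (compoundPoisson l Q)
  obtain ⟨g, H, hH, hgH, heq⟩ := exists_stein_solution_compoundPoisson l Q hQ0 hQm f hf0 hf1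
  have hfb : ∀ w, |f w| ≤ 1 := fun w => by rw [abs_of_nonneg (hf0 w)]; exact hf1 w
  set m := ∫ k, f k ∂(compoundPoisson l Q) with hm
  have hT : ∀ i, ∃ T : Ω → ℕ, AEMeasurable T μ ∧ IndepFun (Y i) T μ ∧
      ∀ ω, Y i ω + T ω = ∑ i, Y i ω := by
    intro i
    refine ⟨∑ j ∈ Finset.univ.erase i, Y j, Finset.aemeasurable_sum _ fun j _ => hYm j,
      (hY.indepFun_finsetSum_of_notMem₀ hYm (Finset.notMem_erase i _)).symm, fun ω => ?_⟩
    rw [Finset.sum_apply, Finset.add_sum_erase _ (fun j => Y j ω) (Finset.mem_univ i)]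
  have hsummand : ∀ i, Integrable (fun ω => (p i : ℝ) * ∫ j : ℕ, j * g ((∑ i, Y i ω) + j) ∂(q i) -
        Y i ω * g (∑ i, Y i ω)) μ ∧
      Integrable (fun ω => bernoulliScore (p i) (q i) (Y i ω) * g (∑ i, Y i ω)) μ ∧
      ∫ ω, ((p i : ℝ) * ∫ j : ℕ, j * g ((∑ i, Y i ω) + j) ∂(q i) -
        Y i ω * g (∑ i, Y i ω)) ∂μ =
      ∫ ω, bernoulliScore (p i) (q i) (Y i ω) * g (∑ i, Y i ω) ∂μ := by
    intro i
    obtain ⟨T, hTm, hind, hsum⟩ := hT i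
    have := integral_stein_summand μ (Y i) T (hYm i) hTm hind (p i) (hp0 i) (hp1 i) (q i) (hlaw i)
      (hq_supp i) (hq_mean i) g H hgH
    simpa only [hsum] using this
  have hmean : ∀ i, ∫ ω, bernoulliScore (p i) (q i) (Y i ω) ∂μ = 0 := by
    intro i
    have h1 := integral_map (hYm i) (f := bernoulliScore (p i) (q i))
      Measurable.of_discrete.aestronglyMeasurable
    have h2 := integrable_bernoulliScore (p i) (q i) (hq_supp i) (hq_mean i) (fun _ => 1) 1 (by simp)
    simp only [mul_one] at h2
    rw [← h1, hlaw, (integral_bernoulliMixture _ (hp0 i) (hp1 i) (q i) _ h2.1).2, h2.2,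
      bernoulliScore_zero]
    simp
  have hlint : ∀ i, ∫⁻ ω, ENNReal.ofReal (bernoulliScore (p i) (q i) (Y i ω) ^ 2) ∂μ =
      ENNReal.ofReal ((p i : ℝ) ^ 3) * convDefect (q i) := by
    intro i
    rw [← lintegral_bernoulliScore_sq _ (hp0 i), ← hlaw,
      lintegral_map' Measurable.of_discrete.aemeasurable (hYm i)]
  have hscm : ∀ i, AEMeasurable (fun ω => bernoulliScore (p i) (q i) (Y i ω)) μ := fun i =>
    (Measurable.of_discrete (f := bernoulliScore (p i) (q i))).comp_aemeasurable (hYm i)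
  have hL2 : ∀ i, MemLp (fun ω => bernoulliScore (p i) (q i) (Y i ω)) 2 μ := by
    intro i
    rw [memLp_two_iff_integrable_sq (hscm i).aestronglyMeasurable]
    refine ⟨((hscm i).pow_const 2).aestronglyMeasurable, ?_⟩
    rw [hasFiniteIntegral_iff_ofReal (Filter.Eventually.of_forall fun ω => sq_nonneg _), hlint]
    exact lt_top_iff_ne_top.2 fun h => hfin (ENNReal.sum_eq_top.2 ⟨i, Finset.mem_univ i, h⟩)
  have hindR : iIndepFun (fun i ω => bernoulliScore (p i) (q i) (Y i ω)) μ :=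
    hY.comp (fun i => bernoulliScore (p i) (q i)) fun i => .of_discrete
  have habs := ofReal_integral_abs_sum_le μ _ hL2 hmean hindR
  simp only [hlint] at habs
  have hstein : tvDist (μ.map (fun ω => ∑ i, Y i ω)) (compoundPoisson l Q) =
      ∫ ω, (∑ i, bernoulliScore (p i) (q i) (Y i ω)) * g (∑ i, Y i ω) ∂μ := by
    have e2 : ∀ w, f w - m = l * ∫ j : ℕ, j * g (w + j) ∂Q - w * g w := fun w => (heq w).symm
    have e3 : tvDist (μ.map (fun ω => ∑ i, Y i ω)) (compoundPoisson l Q) =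
        ∫ ω, (f (∑ i, Y i ω) - m) ∂μ := by
      rw [htv, integral_map hSm Measurable.of_discrete.aestronglyMeasurable, integral_sub _
        (integrable_const m)]
      · simp [hm]
      · have := integrable_of_bounded (μ.map (fun ω => ∑ i, Y i ω)) f 1 hfb
        rwa [integrable_map_measure Measurable.of_discrete.aestronglyMeasurable hSm] at this
    -- Since λQ = ∑ p_i Q_i and S = ∑ Y_i, the Stein operator at S is a sum of one operator per
    -- summand.
    have e4 : ∀ ω, f (∑ i, Y i ω) - m =
        ∑ i, ((p i : ℝ) * ∫ j : ℕ, j * g ((∑ i, Y i ω) + j) ∂(q i) -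
          Y i ω * g (∑ i, Y i ω)) := by
      intro ω
      rw [e2, hQ, (integral_weighted_sum _ hp0 q l hl_pos _ fun i =>
        integrable_mul_bounded (q i) (hq_mean i) (fun j => g ((∑ i, Y i ω) + j)) H
          fun j => hgH _).2, Finset.sum_sub_distrib, ← Finset.sum_mul]
      push_cast
      rfl
    rw [e3]
    simp only [e4, Finset.sum_mul]
    rw [integral_finsetSum _ fun i _ => (hsummand i).1,
      integral_finsetSum _ fun i _ => (hsummand i).2.1]
    exact Finset.sum_congr rfl fun i _ => (hsummand i).2.2
  have hH0 : 0 ≤ H := (abs_nonneg _).trans (hgH 0)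
  have hbound : tvDist (μ.map (fun ω => ∑ i, Y i ω)) (compoundPoisson l Q) ≤
      H * ∫ ω, |∑ i, bernoulliScore (p i) (q i) (Y i ω)| ∂μ := by
    rw [hstein, ← integral_const_mul]
    refine (Real.le_norm_self _).trans (norm_integral_le_of_norm_le ((Integrable.abs
      (integrable_finsetSum _ fun i _ => (hL2 i).integrable one_le_two)).const_mul H)
      (Filter.Eventually.of_forall fun ω => ?_))
    rw [norm_mul, mul_comm]
    exact mul_le_mul_of_nonneg_right (hgH _) (abs_nonneg _)
  calc ENNReal.ofReal (tvDist (μ.map (fun ω => ∑ i, Y i ω)) (compoundPoisson l Q))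
      ≤ ENNReal.ofReal H *
          ENNReal.ofReal (∫ ω, |∑ i, bernoulliScore (p i) (q i) (Y i ω)| ∂μ) := by
        rw [← ENNReal.ofReal_mul hH0]
        exact ENNReal.ofReal_le_ofReal hbound
    _ ≤ _ := mul_le_mul' hH habs
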